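/- Let $A\in\mathbb{R}^{m\times n}$, $b\in\mathbb{R}^m$, $k\ge 1$; $\|\cdot\|$ is the vector or matrix 2-norm. The $k$-step Lanczos bidiagonalization of $A$ with starting vector $b$ is: $\beta_1=\|b\|$, $p_1=b/\beta_1$, $\alpha_1=\|A^Tp_1\|$, $q_1=A^Tp_1/\alpha_1$, and for $j=1,\dots,k$: $s_j=Aq_j-\alpha_jp_j$, $\beta_{j+1}=\|s_j\|$, $p_{j+1}=s_j/\beta_{j+1}$, $r_j=A^Tp_{j+1}-\beta_{j+1}q_j$, $\alpha_{j+1}=\|r_j\|$, $q_{j+1}=r_j/\alpha_{j+1}$. Let $B_k\in\mathbb{R}^{(k+1)\times k}$ be the lower bidiagonal matrix with diagonal $\alpha_1,\dots,\alpha_k$ and subdiagonal $\beta_2,\dots,\beta_{k+1}$, and $Q_k=(q_1,\dots,q_k)$. The $k$-th LSQR iterate is $x_k=Q_ky_k$ with $y_k=\arg\min_{y\in\mathbb{R}^k}\|B_ky-\beta_1e_1\|$. Assume that in exact arithmetic the bidiagonalization of $A$ with starting vector $b$ does not terminate within $k$ steps, that is, $\alpha_j\ne0$ and $\beta_j\neq0$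 for $1\le j\le k+1$. Now run this bidiagonalization with full reorthogonalization in floating point arithmetic with roundoff unit $\mathbf u$: every elementary operation $+,-,\times,/,\sqrt{\ }$ returns the exact result up to a relative error of at most $\mathbf u$, sums being evaluated in any order; and, before it is normalized, each $s_j$ (respectively $r_j$) is reorthogonalized against all of $p_1,\dots,p_j$ (respectively $q_1,\dots,q_j$) by a fixed number $r\ge1$ of classical or modified Gram–Schmidt sweeps. Let $x_k=Q_ky_k$ be formed from the computed $Q_k$, $B_k$, $\beta_1$, the projected problem $\min_y\|B_ky-\beta_1e_1\|$ being solved (and the product $Q_ky_k$ formed) exactly. Then, for the chosen kind of Gram–Schmidt sweep and the chosen $r$, there is a constant $c(m,n,k)$, bounded by a polynomial in $m+n+k$ and independent of $A$, $b$, $\mathbf u$ and of the rounding errors, such that for all sufficiently small $\mathbf u>0$ (how small may depend on $A$, $b$, $k$, but not on the rounding errors) there exist $E\in\mathbb{R}^{m\times n}$ and $\delta_b\in\mathbb{R}^m$ with $$\|E\|\le c(m,n,k)\,\|A\|\,\mathbf u,\qquad \|\delta_b\|\le c(m,n,k)\,\|b\|\,\mathbf u,$$ such that the exact bidiagonalization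 of $A+E$ with starting vector $b+\delta_b$ does not terminate within $k$ steps and the exact $k$-th LSQR iterate $\bar x_k$ for $\min_x\|(A+E)x-(b+\delta_b)\|$ is nonzero and satisfies $$\frac{\|x_k-\bar x_k\|}{\|\bar x_k\|}\le c(m,n,k)\,\mathbf u .$$ -/

import Mathlib

open scoped Matrix.Norms.L2Operator

/-- `SumEval fl s a`: the number `a` is obtained from the nonempty multiset of summands `s` by
successive binary additions `fl`, carried out in some order. -/
inductive SumEval (fl : ℝ → ℝ → ℝ) : Multiset ℝ → ℝ → Prop
  | single (x : ℝ) : SumEval fl {x} x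
  | combine {s t : Multiset ℝ} {x y : ℝ} (hs : SumEval fl s x) (ht : SumEval fl t y) :
      SumEval fl (s + t) (fl x y)

/-- Floating point arithmetic with roundoff unit `u` (standard model, no overflow or underflow):
each elementary operation returns the exact result up to a relative error of at most `u`.
`flSum` is the order in which sums of more than two terms are evaluated; it is arbitrary. -/
structure FloatArith (u : ℝ) where
  flAdd : ℝ → ℝ → ℝ
  flSub : ℝ → ℝ → ℝ
  flMul : ℝ → ℝ → ℝ
  flDiv : ℝ → ℝ → ℝ
  flSqrt : ℝ → ℝ
  flSum : List ℝ → ℝ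
  flAdd_spec : ∀ x y : ℝ, ∃ ε : ℝ, |ε| ≤ u ∧ flAdd x y = (x + y) * (1 + ε)
  flSub_spec : ∀ x y : ℝ, ∃ ε : ℝ, |ε| ≤ u ∧ flSub x y = (x - y) * (1 + ε)
  flMul_spec : ∀ x y : ℝ, ∃ ε : ℝ, |ε| ≤ u ∧ flMul x y = (x * y) * (1 + ε)
  flDiv_spec : ∀ x y : ℝ, y ≠ 0 → ∃ ε : ℝ, |ε| ≤ u ∧ flDiv x y = (x / y) * (1 + ε)
  flSqrt_spec : ∀ x : ℝ, 0 ≤ x → ∃ ε : ℝ, |ε| ≤ u ∧ flSqrt x = Real.sqrt x * (1 + ε)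
  flSum_spec : ∀ l : List ℝ, l ≠ [] → SumEval flAdd (l : Multiset ℝ) (flSum l)

namespace FloatArith

variable {u : ℝ} (F : FloatArith u) {m n : ℕ}

/-- Computed difference of two vectors. -/
def vecSub (x y : EuclideanSpace ℝ (Fin n)) : EuclideanSpace ℝ (Fin n) :=
  WithLp.toLp 2 fun i => F.flSub (x i) (y i)

/-- Computed multiple of a vector by a scalar. -/
def vecScale (c : ℝ) (x : EuclideanSpace ℝ (Fin n)) : EuclideanSpace ℝ (Fin n) :=
  WithLp.toLp 2 fun i => F.flMul c (x i)

/-- Computed quotient of a vector by a scalar. -/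
def vecDiv (x : EuclideanSpace ℝ (Fin n)) (c : ℝ) : EuclideanSpace ℝ (Fin n) :=
  WithLp.toLp 2 fun i => F.flDiv (x i) c

/-- Computed inner product. -/
def dot (x y : EuclideanSpace ℝ (Fin n)) : ℝ :=
  F.flSum (List.ofFn fun i => F.flMul (x i) (y i))

/-- Computed Euclidean norm. -/
def vecNorm (x : EuclideanSpace ℝ (Fin n)) : ℝ :=
  F.flSqrt (F.dot x x)

/-- Computed matrix-vector product. -/
def matVec (A : Matrix (Fin m) (Fin n) ℝ) (x : EuclideanSpace ℝ (Fin n)) :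
    EuclideanSpace ℝ (Fin m) :=
  WithLp.toLp 2 fun i => F.dot (WithLp.toLp 2 (A i)) x

end FloatArith

/-- The classical and the modified Gram–Schmidt process. -/
inductive GramSchmidtKind
  | classical
  | modified

namespace FloatArith

variable {u : ℝ} (F : FloatArith u) {m n : ℕ}

/-- One computed Gram–Schmidt sweep of `z` against the vectors of the list `L`. -/
def gsPass : GramSchmidtKind → List (EuclideanSpace ℝ (Fin n)) →
    EuclideanSpace ℝ (Fin n) → EuclideanSpace ℝ (Fin n)
  | .classical, L, z => L.foldl (fun v w => F.vecSub v (F.vecScale (F.dot w z) w)) z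
  | .modified, L, z => L.foldl (fun v w => F.vecSub v (F.vecScale (F.dot w v) w)) z

/-- Computed reorthogonalization of `z` against `w 1, …, w j`, by `r` successive sweeps. -/
def reorth (g : GramSchmidtKind) (r : ℕ) (w : ℕ → EuclideanSpace ℝ (Fin n)) (j : ℕ)
    (z : EuclideanSpace ℝ (Fin n)) : EuclideanSpace ℝ (Fin n) :=
  (F.gsPass g ((List.range' 1 j).map w))^[r] z

/-- The quantities `p 1, …, p (k+1)`, `q 1, …, q (k+1)`, `α 1, …, α (k+1)`, `β 1, …, β (k+1)` are
those computed in the floating point arithmetic `F` by the `k`-step Lanczos bidiagonalization with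
full reorthogonalization of `A` with starting vector `b`: each new vector is reorthogonalized
against all previous ones before it is normalized. Entries with index `0` or index above `k + 1`
are irrelevant. -/
structure IsLBFRO (g : GramSchmidtKind) (r : ℕ) (A : Matrix (Fin m) (Fin n) ℝ)
    (b : EuclideanSpace ℝ (Fin m)) (k : ℕ)
    (p : ℕ → EuclideanSpace ℝ (Fin m)) (q : ℕ → EuclideanSpace ℝ (Fin n))
    (α β : ℕ → ℝ) : Prop where
  beta_one : β 1 = F.vecNorm b
  p_one : p 1 = F.vecDiv b (β 1)
  alpha_one : α 1 = F.vecNorm (F.matVec A.transpose (p 1))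
  q_one : q 1 = F.vecDiv (F.matVec A.transpose (p 1)) (α 1)
  p_step : ∀ j, 1 ≤ j → j ≤ k → ∃ s : EuclideanSpace ℝ (Fin m),
    s = F.reorth g r p j (F.vecSub (F.matVec A (q j)) (F.vecScale (α j) (p j))) ∧
    β (j + 1) = F.vecNorm s ∧ p (j + 1) = F.vecDiv s (β (j + 1))
  q_step : ∀ j, 1 ≤ j → j ≤ k → ∃ t : EuclideanSpace ℝ (Fin n),
    t = F.reorth g r q j
      (F.vecSub (F.matVec A.transpose (p (j + 1))) (F.vecScale (β (j + 1)) (q j))) ∧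
    α (j + 1) = F.vecNorm t ∧ q (j + 1) = F.vecDiv t (α (j + 1))

end FloatArith

/-- The exact product of a matrix and a vector of Euclidean space. -/
def eucMulVec {m n : ℕ} (A : Matrix (Fin m) (Fin n) ℝ) (x : EuclideanSpace ℝ (Fin n)) :
    EuclideanSpace ℝ (Fin m) :=
  WithLp.toLp 2 (A.mulVec x.ofLp)

/-- The `k`-step Lanczos bidiagonalization of `A` with starting vector `b` in exact arithmetic
runs without breakdown (no `α j`, `β j` with `1 ≤ j ≤ k + 1` vanishes) and produces
`p j`, `q j`, `α j`, `β j`, `1 ≤ j ≤ k + 1`. -/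
structure IsLanczosBidiag {m n : ℕ} (A : Matrix (Fin m) (Fin n) ℝ)
    (b : EuclideanSpace ℝ (Fin m)) (k : ℕ)
    (p : ℕ → EuclideanSpace ℝ (Fin m)) (q : ℕ → EuclideanSpace ℝ (Fin n))
    (α β : ℕ → ℝ) : Prop where
  beta_one : β 1 = ‖b‖
  p_one : p 1 = (β 1)⁻¹ • b
  alpha_one : α 1 = ‖eucMulVec A.transpose (p 1)‖
  q_one : q 1 = (α 1)⁻¹ • eucMulVec A.transpose (p 1)
  beta_step : ∀ j, 1 ≤ j → j ≤ k → β (j + 1) = ‖eucMulVec A (q j) - α j • p j‖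
  p_step : ∀ j, 1 ≤ j → j ≤ k →
    p (j + 1) = (β (j + 1))⁻¹ • (eucMulVec A (q j) - α j • p j)
  alpha_step : ∀ j, 1 ≤ j → j ≤ k →
    α (j + 1) = ‖eucMulVec A.transpose (p (j + 1)) - β (j + 1) • q j‖
  q_step : ∀ j, 1 ≤ j → j ≤ k →
    q (j + 1) = (α (j + 1))⁻¹ • (eucMulVec A.transpose (p (j + 1)) - β (j + 1) • q j)
  alpha_ne_zero : ∀ j, 1 ≤ j → j ≤ k + 1 → α j ≠ 0
  beta_ne_zero : ∀ j, 1 ≤ j → j ≤ k + 1 → β j ≠ 0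

/-- The `(k+1) × k` lower bidiagonal matrix with diagonal `α 1, …, α k` and subdiagonal
`β 2, …, β (k+1)`. -/
def bidiagMatrix (α β : ℕ → ℝ) (k : ℕ) : Matrix (Fin (k + 1)) (Fin k) ℝ :=
  Matrix.of fun i j =>
    if (i : ℕ) = j then α (j + 1) else if (i : ℕ) = j + 1 then β (j + 2) else 0

/-- `x = ∑ j, y j • q j`, where `y` minimizes `‖B y - β 1 • e₁‖` exactly, `B` being the
bidiagonal matrix of `α`, `β`. -/
def IsProjectedSolution {n : ℕ} (α β : ℕ → ℝ) (q : ℕ → EuclideanSpace ℝ (Fin n)) (k : ℕ)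
    (x : EuclideanSpace ℝ (Fin n)) : Prop :=
  ∃ y : EuclideanSpace ℝ (Fin k),
    (∀ z : EuclideanSpace ℝ (Fin k),
      ‖eucMulVec (bidiagMatrix α β k) y - EuclideanSpace.single 0 (β 1)‖ ≤
        ‖eucMulVec (bidiagMatrix α β k) z - EuclideanSpace.single 0 (β 1)‖) ∧
    x = ∑ j : Fin k, y j • q (j + 1)

/-- `x` is the `k`-th LSQR iterate, in exact arithmetic, for `min ‖A x - b‖` (the underlying
Lanczos bidiagonalization does not break down). -/
def IsLSQRIterate {m n : ℕ} (A : Matrix (Fin m) (Fin n) ℝ) (b : EuclideanSpace ℝ (Fin m))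
    (k : ℕ) (x : EuclideanSpace ℝ (Fin n)) : Prop :=
  ∃ (p : ℕ → EuclideanSpace ℝ (Fin m)) (q : ℕ → EuclideanSpace ℝ (Fin n)) (α β : ℕ → ℝ),
    IsLanczosBidiag A b k p q α β ∧ IsProjectedSolution α β q k x

/-!
The argument follows the computed bidiagonalization to first order in the roundoff unit `u`, along
the filter of all runs with `u → 0`. In this limit the computed vectors and coefficients tend to the
exact ones, so the product of an `O(u)` term with a term that vanishes in the exact algorithm is
`o(u)`. `FloatFamily.FirstOrder C X` records the first-order constant `C` of an error `X`, and
thereby keeps every constant independent of `A` and `b`; the threshold for `u` is where the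
dependence on the conditioning of the problem goes.

The vector to be reorthogonalized is orthogonal to the previous ones up to `O(u)` and has the size
of the next coefficient. Hence the coefficients of a Gram–Schmidt sweep tend to zero, its rounding
errors are relative to the vector itself, and already one sweep yields orthogonality up to a
multiple of `u` that depends on the dimensions only (`FloatFamily.firstOrder_gsPass`,
`FloatFamily.firstOrder_reorth`). The size of the correction made by the sweeps enters the residuals
of the recurrences. To bound it without letting constants grow from step to step, one uses that the
correction lies, up to rounding errors, in the span of the previous vectors, so that its components
along later vectors are `o(u)` (`FloatFamily.NearlyLanczos.step`). As a result, both sequences are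
orthonormal up to `O(u)`, and the recurrences hold up to residuals of size `O(u ‖A‖)`
(`FloatFamily.nearlyLanczos_of_isLBFRO`).

The rest is exact linear algebra (`exists_backward_error`). Nearly orthonormal vectors are replaced
by orthonormal ones at distance `O(u)` (`exists_orthonormal_near`), with the coefficients `α`, `β`
kept. The residuals `F` of `A Q = P B` and `G` of `Aᵀ P = Q Bᵀ` that result are compatible, in the
sense that `Pᵀ F = Gᵀ Q`, so that `E = F Qᵀ + P Gᵀ - P Pᵀ F Qᵀ` satisfies `E Q = F` and `Eᵀ P = G`
(`exists_matrix_of_orthonormalUpTo`). The replaced vectors are thus the exact Lanczos vectors of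
`A + E` and of the starting vector `β 1 • p 1`, and the projected problem is the same for both
iterates, which therefore differ only by the replacement of the vectors.
-/

open Filter Topology

/-! ### Matrix-vector products in Euclidean space -/

theorem eucMulVec_eq_toEuclideanLin {m n : ℕ} (A : Matrix (Fin m) (Fin n) ℝ)
    (x : EuclideanSpace ℝ (Fin n)) : eucMulVec A x = Matrix.toEuclideanLin A x := rfl

theorem eucMulVec_sub {m n : ℕ} (A : Matrix (Fin m) (Fin n) ℝ)
    (x y : EuclideanSpace ℝ (Fin n)) :
    eucMulVec A (x - y) = eucMulVec A x - eucMulVec A y := by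
  simp only [eucMulVec_eq_toEuclideanLin, map_sub]

theorem eucMulVec_add_matrix {m n : ℕ} (A B : Matrix (Fin m) (Fin n) ℝ)
    (x : EuclideanSpace ℝ (Fin n)) :
    eucMulVec (A + B) x = eucMulVec A x + eucMulVec B x := by
  simp [eucMulVec, Matrix.add_mulVec]

theorem norm_eucMulVec_le {m n : ℕ} (A : Matrix (Fin m) (Fin n) ℝ)
    (x : EuclideanSpace ℝ (Fin n)) : ‖eucMulVec A x‖ ≤ ‖A‖ * ‖x‖ :=
  A.l2_opNorm_mulVec x

theorem norm_transpose_eq {m n : ℕ} (A : Matrix (Fin m) (Fin n) ℝ) : ‖A.transpose‖ = ‖A‖ := by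
  rw [← Matrix.conjTranspose_eq_transpose_of_trivial, Matrix.l2_opNorm_conjTranspose]

theorem continuous_eucMulVec {m n : ℕ} (A : Matrix (Fin m) (Fin n) ℝ) :
    Continuous (eucMulVec A) :=
  LinearMap.continuous_of_finiteDimensional (Matrix.toEuclideanLin A)

theorem inner_eucMulVec_left {m n : ℕ} (A : Matrix (Fin m) (Fin n) ℝ)
    (x : EuclideanSpace ℝ (Fin n)) (y : EuclideanSpace ℝ (Fin m)) :
    inner ℝ (eucMulVec A x) y = inner ℝ x (eucMulVec A.transpose y) := by
  simp only [eucMulVec, EuclideanSpace.inner_eq_star_dotProduct, star_trivial]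
  rw [Matrix.dotProduct_mulVec, Matrix.mulVec_transpose]

theorem norm_row_le {m n : ℕ} (A : Matrix (Fin m) (Fin n) ℝ) (i : Fin m) :
    ‖(WithLp.toLp 2 (A i) : EuclideanSpace ℝ (Fin n))‖ ≤ ‖A‖ := by
  have h : (WithLp.toLp 2 (A i) : EuclideanSpace ℝ (Fin n)) =
      eucMulVec A.transpose (EuclideanSpace.single i 1) := by
    ext j
    simp [eucMulVec]
  rw [h, ← norm_transpose_eq A]
  simpa using norm_eucMulVec_le A.transpose (EuclideanSpace.single i 1)

/-! ### Rounding errors of the elementary vector operations -/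

/-- Componentwise domination of Euclidean vectors gives domination of the norms. -/
theorem EuclideanSpace.norm_le_mul_of_abs_le {n : ℕ} {x y : EuclideanSpace ℝ (Fin n)} {c : ℝ}
    (hc : 0 ≤ c) (h : ∀ i, |x i| ≤ c * |y i|) : ‖x‖ ≤ c * ‖y‖ := by
  rw [EuclideanSpace.norm_eq, EuclideanSpace.norm_eq, Real.sqrt_le_left (by positivity), mul_pow,
    Real.sq_sqrt (Finset.sum_nonneg fun i _ => by positivity), Finset.mul_sum]
  refine Finset.sum_le_sum fun i _ => ?_
  rw [← mul_pow]
  exact pow_le_pow_left₀ (norm_nonneg _) (h i) 2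

theorem EuclideanSpace.sum_abs_mul_le {n : ℕ} (x y : EuclideanSpace ℝ (Fin n)) :
    ∑ i, |x i * y i| ≤ ‖x‖ * ‖y‖ := by
  rw [EuclideanSpace.norm_eq, EuclideanSpace.norm_eq]
  simpa [abs_mul] using
    Real.sum_mul_le_sqrt_mul_sqrt Finset.univ (fun i => |x i|) (fun i => |y i|)

/-- A summation carried out in any order with rounding errors at most `u` has an error of at most
`(1 + u) ^ N - 1` relative to the sum of the absolute values of its `N` terms. -/
theorem SumEval.error_le {fl : ℝ → ℝ → ℝ} {u : ℝ} (hu : 0 ≤ u)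
    (hfl : ∀ x y : ℝ, ∃ ε : ℝ, |ε| ≤ u ∧ fl x y = (x + y) * (1 + ε))
    {s : Multiset ℝ} {a : ℝ} (h : SumEval fl s a) :
    1 ≤ s.card ∧ |a - s.sum| ≤ ((1 + u) ^ s.card - 1) * (s.map abs).sum := by
  induction h with
  | single x =>
    refine ⟨by simp, ?_⟩
    simp only [Multiset.sum_singleton, sub_self, abs_zero, Multiset.card_singleton, pow_one,
      Multiset.map_singleton, add_sub_cancel_left]
    positivity
  | @combine s t x y hs ht ihs iht =>
    obtain ⟨cs, ihs⟩ := ihs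
    obtain ⟨ct, iht⟩ := iht
    obtain ⟨ε, hε, hxy⟩ := hfl x y
    refine ⟨by rw [Multiset.card_add]; omega, ?_⟩
    rw [Multiset.card_add, Multiset.sum_add, Multiset.map_add, Multiset.sum_add, hxy]
    set N := s.card + t.card
    set S := (s.map abs).sum
    set T := (t.map abs).sum
    have hS : |s.sum| ≤ S := Multiset.abs_sum_le_sum_abs
    have hT : |t.sum| ≤ T := Multiset.abs_sum_le_sum_abs
    have hS0 : 0 ≤ S := (abs_nonneg _).trans hS
    have hT0 : 0 ≤ T := (abs_nonneg _).trans hT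
    -- Each partial sum uses at most `N - 1` summands, which leaves one factor `1 + u`
    -- for the present addition.
    have e1 : (1 + u) ^ s.card ≤ (1 + u) ^ (N - 1) :=
      pow_le_pow_right₀ (by linarith) (by omega)
    have e2 : (1 + u) ^ t.card ≤ (1 + u) ^ (N - 1) :=
      pow_le_pow_right₀ (by linarith) (by omega)
    have e3 : (1 + u) ^ N = (1 + u) ^ (N - 1) * (1 + u) := by
      rw [← pow_succ]; congr 1; omega
    set P := (1 + u) ^ (N - 1)
    have b1 : |x - s.sum| ≤ (P - 1) * S := ihs.trans (by gcongr)
    have b2 : |y - t.sum| ≤ (P - 1) * T := iht.trans (by gcongr)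
    have hd : |x + y - (s.sum + t.sum)| ≤ (P - 1) * (S + T) := by
      have : x + y - (s.sum + t.sum) = (x - s.sum) + (y - t.sum) := by ring
      rw [this]
      exact (abs_add_le _ _).trans (by linarith)
    have hxy' : |x + y| ≤ P * (S + T) := by
      have : x + y = (x + y - (s.sum + t.sum)) + (s.sum + t.sum) := by ring
      rw [this]
      refine (abs_add_le _ _).trans ?_
      have := abs_add_le s.sum t.sum
      linarith
    have : (x + y) * (1 + ε) - (s.sum + t.sum) =
        (x + y - (s.sum + t.sum)) + (x + y) * ε := by ring
    rw [this, e3]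
    refine (abs_add_le _ _).trans ?_
    rw [abs_mul]
    have := mul_le_mul hxy' hε (abs_nonneg _) ((abs_nonneg _).trans hxy')
    linarith

namespace FloatArith

variable {u : ℝ} (F : FloatArith u) {m n : ℕ}

theorem norm_vecSub_sub_le (hu : 0 ≤ u) (x y : EuclideanSpace ℝ (Fin n)) :
    ‖F.vecSub x y - (x - y)‖ ≤ u * ‖x - y‖ := by
  refine EuclideanSpace.norm_le_mul_of_abs_le hu fun i => ?_
  obtain ⟨ε, hε, h⟩ := F.flSub_spec (x i) (y i)
  have : (F.vecSub x y - (x - y)) i = ε * (x - y) i := by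
    simp [vecSub, h]; ring
  rw [this, abs_mul]
  gcongr

theorem norm_vecScale_sub_le (hu : 0 ≤ u) (c : ℝ) (x : EuclideanSpace ℝ (Fin n)) :
    ‖F.vecScale c x - c • x‖ ≤ u * ‖c • x‖ := by
  refine EuclideanSpace.norm_le_mul_of_abs_le hu fun i => ?_
  obtain ⟨ε, hε, h⟩ := F.flMul_spec c (x i)
  have : (F.vecScale c x - c • x) i = ε * (c • x) i := by
    simp [vecScale, h]; ring
  rw [this, abs_mul]
  gcongr

theorem norm_vecDiv_sub_le (hu : 0 ≤ u) (x : EuclideanSpace ℝ (Fin n)) {c : ℝ} (hc : c ≠ 0) :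
    ‖F.vecDiv x c - c⁻¹ • x‖ ≤ u * ‖c⁻¹ • x‖ := by
  refine EuclideanSpace.norm_le_mul_of_abs_le hu fun i => ?_
  obtain ⟨ε, hε, h⟩ := F.flDiv_spec (x i) c hc
  have : (F.vecDiv x c - c⁻¹ • x) i = ε * (c⁻¹ • x) i := by
    simp [vecDiv, h]; ring
  rw [this, abs_mul]
  gcongr

theorem abs_dot_sub_le (hu : 0 ≤ u) (hn : 0 < n) (x y : EuclideanSpace ℝ (Fin n)) :
    |F.dot x y - inner ℝ x y| ≤ ((1 + u) ^ (n + 1) - 1) * (‖x‖ * ‖y‖) := by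
  have hspec := F.flSum_spec (List.ofFn fun i => F.flMul (x i) (y i))
    (by simp [List.ofFn_eq_nil_iff]; omega)
  obtain ⟨-, h⟩ := hspec.error_le hu F.flAdd_spec
  rw [Multiset.coe_card, List.length_ofFn, Multiset.sum_coe, Multiset.map_coe,
    Multiset.sum_coe, List.map_ofFn, List.sum_ofFn, List.sum_ofFn] at h
  have hmul : ∀ i, |F.flMul (x i) (y i) - x i * y i| ≤ u * |x i * y i| := fun i => by
    obtain ⟨ε, hε, h⟩ := F.flMul_spec (x i) (y i)
    have : F.flMul (x i) (y i) - x i * y i = ε * (x i * y i) := by rw [h]; ring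
    rw [this, abs_mul]
    gcongr
  have hin : inner ℝ x y = ∑ i, x i * y i := by
    simp [PiLp.inner_apply, mul_comm]
  set M := ∑ i, |x i * y i|
  have h1 : ∑ i, |F.flMul (x i) (y i)| ≤ (1 + u) * M := by
    rw [Finset.mul_sum]
    refine Finset.sum_le_sum fun i _ => ?_
    have := abs_sub_abs_le_abs_sub (F.flMul (x i) (y i)) (x i * y i)
    linarith [hmul i]
  have h2 : |∑ i, F.flMul (x i) (y i) - ∑ i, x i * y i| ≤ u * M := by
    rw [← Finset.sum_sub_distrib, Finset.mul_sum]
    exact (Finset.abs_sum_le_sum_abs _ _).trans (Finset.sum_le_sum fun i _ => hmul i)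
  have hP : 1 ≤ (1 + u) ^ n := one_le_pow₀ (by linarith)
  have h3 : |F.dot x y - inner ℝ x y| ≤ ((1 + u) ^ (n + 1) - 1) * M := by
    rw [hin]
    refine (abs_sub_le _ (∑ i, F.flMul (x i) (y i)) _).trans ?_
    have h4 : |F.dot x y - ∑ i, F.flMul (x i) (y i)| ≤ ((1 + u) ^ n - 1) * ((1 + u) * M) :=
      h.trans (mul_le_mul_of_nonneg_left h1 (by linarith))
    rw [pow_succ]
    linarith
  refine h3.trans (mul_le_mul_of_nonneg_left (EuclideanSpace.sum_abs_mul_le x y) ?_)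
  have : 1 ≤ (1 + u) ^ (n + 1) := one_le_pow₀ (by linarith)
  linarith

theorem norm_matVec_sub_le (hu : 0 ≤ u) (hn : 0 < n) (A : Matrix (Fin m) (Fin n) ℝ)
    (x : EuclideanSpace ℝ (Fin n)) :
    ‖F.matVec A x - eucMulVec A x‖ ≤ ((1 + u) ^ (n + 1) - 1) * (m * ‖A‖ * ‖x‖) := by
  have hP : 0 ≤ (1 + u) ^ (n + 1) - 1 := by
    have : 1 ≤ (1 + u) ^ (n + 1) := one_le_pow₀ (by linarith)
    linarith
  have hcomp : ∀ i, |(F.matVec A x - eucMulVec A x) i| ≤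
      ((1 + u) ^ (n + 1) - 1) * (‖A‖ * ‖x‖) := fun i => by
    have h1 : eucMulVec A x i = inner ℝ (WithLp.toLp 2 (A i) : EuclideanSpace ℝ (Fin n)) x := by
      simp [eucMulVec, Matrix.mulVec, dotProduct, PiLp.inner_apply, mul_comm]
    have h2 := F.abs_dot_sub_le hu hn (WithLp.toLp 2 (A i)) x
    rw [PiLp.sub_apply, h1]
    refine h2.trans ?_
    gcongr
    exact norm_row_le A i
  have hsum : ∀ z : EuclideanSpace ℝ (Fin m), ‖z‖ ≤ ∑ i, |z i| := fun z => by
    conv_lhs => rw [← (EuclideanSpace.basisFun (Fin m) ℝ).sum_repr z]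
    refine (norm_sum_le _ _).trans (Finset.sum_le_sum fun i _ => ?_)
    simp [norm_smul]
  refine (hsum _).trans ((Finset.sum_le_sum fun i _ => hcomp i).trans ?_)
  simp only [Finset.sum_const, Finset.card_univ, Fintype.card_fin, nsmul_eq_mul]
  exact le_of_eq (by ring)

end FloatArith

/-! ### First-order error calculus -/

/-- A family of floating point arithmetics, indexed by `Ω`, together with a filter along which the
roundoff unit tends to zero. -/
structure FloatFamily (Ω : Type*) where
  /-- the roundoff unit -/
  u : Ω → ℝ
  u_nonneg : ∀ ω, 0 ≤ u ω
  /-- the arithmetic -/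
  F : ∀ ω, FloatArith (u ω)
  /-- the filter of small roundoff units -/
  l : Filter Ω
  tendsto_u : Tendsto u l (𝓝 0)

namespace FloatFamily

variable {Ω : Type*} (φ : FloatFamily Ω)

/-- `X` is bounded by `C u` up to terms of higher order in the roundoff unit `u`. With `C = 0` this
says that `X = o(u)`. -/
def FirstOrder {E : Type*} [Norm E] (C : ℝ) (X : Ω → E) : Prop :=
  ∃ θ : Ω → ℝ, Tendsto θ φ.l (𝓝 C) ∧ ∀ᶠ ω in φ.l, ‖X ω‖ ≤ θ ω * φ.u ω

variable {φ}

namespace FirstOrder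

section Normed

variable {E : Type*} [SeminormedAddCommGroup E] {C C' : ℝ} {X Y : Ω → E}

theorem zero : φ.FirstOrder 0 (fun _ => (0 : E)) :=
  ⟨fun _ => 0, tendsto_const_nhds, by simp⟩

theorem mono (h : φ.FirstOrder C X) (hC : C ≤ C') : φ.FirstOrder C' X := by
  obtain ⟨θ, hθ, hX⟩ := h
  refine ⟨fun ω => θ ω + (C' - C), by simpa using hθ.add_const (C' - C), ?_⟩
  filter_upwards [hX] with ω h
  nlinarith [φ.u_nonneg ω]

theorem congr (h : φ.FirstOrder C X) (hC : C ≤ C') (hXY : ∀ ω, Y ω = X ω) :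
    φ.FirstOrder C' Y := by
  obtain rfl : Y = X := funext hXY
  exact h.mono hC

theorem add (hX : φ.FirstOrder C X) (hY : φ.FirstOrder C' Y) :
    φ.FirstOrder (C + C') (fun ω => X ω + Y ω) := by
  obtain ⟨θ, hθ, hX⟩ := hX
  obtain ⟨η, hη, hY⟩ := hY
  refine ⟨fun ω => θ ω + η ω, hθ.add hη, ?_⟩
  filter_upwards [hX, hY] with ω h1 h2
  exact (norm_add_le _ _).trans (by linarith)

theorem neg (hX : φ.FirstOrder C X) : φ.FirstOrder C (fun ω => -X ω) := by
  obtain ⟨θ, hθ, hX⟩ := hX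
  exact ⟨θ, hθ, by simpa using hX⟩

theorem sub (hX : φ.FirstOrder C X) (hY : φ.FirstOrder C' Y) :
    φ.FirstOrder (C + C') (fun ω => X ω - Y ω) := by
  simpa [sub_eq_add_neg] using hX.add hY.neg

theorem norm (hX : φ.FirstOrder C X) : φ.FirstOrder C (fun ω => ‖X ω‖) := by
  simpa [FirstOrder] using hX

theorem tendsto_zero (hX : φ.FirstOrder C X) : Tendsto X φ.l (𝓝 0) := by
  obtain ⟨θ, hθ, hX⟩ := hX
  exact squeeze_zero_norm' hX (by simpa using hθ.mul φ.tendsto_u)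

theorem tendsto {y : E} (h : φ.FirstOrder C (fun ω => X ω - Y ω)) (hY : Tendsto Y φ.l (𝓝 y)) :
    Tendsto X φ.l (𝓝 y) := by
  simpa using h.tendsto_zero.add hY

theorem eventually_le (h : φ.FirstOrder C X) (hC : C < C') :
    ∀ᶠ ω in φ.l, ‖X ω‖ ≤ C' * φ.u ω := by
  obtain ⟨θ, hθ, hX⟩ := h
  filter_upwards [hX, hθ.eventually_lt_const hC] with ω h1 h2
  exact h1.trans (mul_le_mul_of_nonneg_right h2.le (φ.u_nonneg ω))

end Normed

section Mul

variable {E G K : Type*} [SeminormedAddCommGroup E] [SeminormedAddCommGroup G]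
  [SeminormedAddCommGroup K] {C : ℝ}

theorem of_norm_le_mul {X : Ω → E} {Y : Ω → G} {y : G} {Z : Ω → K} (hX : φ.FirstOrder C X)
    (hY : Tendsto Y φ.l (𝓝 y)) (h : ∀ᶠ ω in φ.l, ‖Z ω‖ ≤ ‖X ω‖ * ‖Y ω‖) :
    φ.FirstOrder (C * ‖y‖) Z := by
  obtain ⟨θ, hθ, hX⟩ := hX
  refine ⟨fun ω => θ ω * ‖Y ω‖, hθ.mul hY.norm, ?_⟩
  filter_upwards [hX, h] with ω h1 h2
  have := mul_le_mul_of_nonneg_right h1 (norm_nonneg (Y ω))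
  linarith

theorem mul {X Y : Ω → ℝ} {y : ℝ} (hX : φ.FirstOrder C X) (hY : Tendsto Y φ.l (𝓝 y)) :
    φ.FirstOrder (C * |y|) (fun ω => X ω * Y ω) :=
  hX.of_norm_le_mul hY (.of_forall fun _ => (norm_mul _ _).le)

theorem smul_vec [NormedSpace ℝ G] {X : Ω → ℝ} {Y : Ω → G} {y : G} (hX : φ.FirstOrder C X)
    (hY : Tendsto Y φ.l (𝓝 y)) : φ.FirstOrder (C * ‖y‖) (fun ω => X ω • Y ω) :=
  hX.of_norm_le_mul hY (.of_forall fun _ => (norm_smul _ _).le)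

end Mul

section Inner

variable {E : Type*} [NormedAddCommGroup E] [InnerProductSpace ℝ E] {C : ℝ} {X Y : Ω → E} {y : E}

theorem inner_left (hX : φ.FirstOrder C X) (hY : Tendsto Y φ.l (𝓝 y)) :
    φ.FirstOrder (C * ‖y‖) (fun ω => inner ℝ (X ω) (Y ω)) :=
  hX.of_norm_le_mul hY (.of_forall fun _ => norm_inner_le_norm _ _)

theorem inner_right (hX : φ.FirstOrder C X) (hY : Tendsto Y φ.l (𝓝 y)) :
    φ.FirstOrder (C * ‖y‖) (fun ω => inner ℝ (Y ω) (X ω)) := by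
  simpa only [real_inner_comm] using hX.inner_left hY

end Inner

end FirstOrder

theorem firstOrder_u : φ.FirstOrder 1 φ.u :=
  ⟨fun _ => 1, tendsto_const_nhds, .of_forall fun ω => by simp [abs_of_nonneg (φ.u_nonneg ω)]⟩

theorem firstOrder_of_le_u_mul {E G : Type*} [SeminormedAddCommGroup E] [SeminormedAddCommGroup G]
    {Z : Ω → E} {Y : Ω → G} {y : G} (hY : Tendsto Y φ.l (𝓝 y))
    (h : ∀ᶠ ω in φ.l, ‖Z ω‖ ≤ φ.u ω * ‖Y ω‖) : φ.FirstOrder ‖y‖ Z := by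
  rw [← one_mul ‖y‖]
  refine firstOrder_u.of_norm_le_mul hY ?_
  simpa [abs_of_nonneg (φ.u_nonneg _)] using h

theorem firstOrder_one_add_u_pow (t : ℕ) :
    φ.FirstOrder (t : ℝ) (fun ω => (1 + φ.u ω) ^ t - 1) := by
  refine ⟨fun ω => ∑ i ∈ Finset.range t, (1 + φ.u ω) ^ i, ?_, .of_forall fun ω => ?_⟩
  · have : Tendsto (fun ω => ∑ i ∈ Finset.range t, (1 + φ.u ω) ^ i) φ.l
        (𝓝 (∑ i ∈ Finset.range t, (1 + (0 : ℝ)) ^ i)) :=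
      tendsto_finsetSum _ fun i _ => (φ.tendsto_u.const_add 1).pow i
    simpa using this
  · beta_reduce
    rw [← geom_sum_mul, Real.norm_of_nonneg]
    · simp
    · have := φ.u_nonneg ω
      simp only [add_sub_cancel_left]
      positivity

/-! ### Rounding errors to first order -/

variable {m n : ℕ}

theorem firstOrder_dot (hn : 0 < n) {x y : Ω → EuclideanSpace ℝ (Fin n)}
    {x₀ y₀ : EuclideanSpace ℝ (Fin n)} (hx : Tendsto x φ.l (𝓝 x₀)) (hy : Tendsto y φ.l (𝓝 y₀)) :
    φ.FirstOrder ((n + 1) * (‖x₀‖ * ‖y₀‖))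
      (fun ω => (φ.F ω).dot (x ω) (y ω) - inner ℝ (x ω) (y ω)) := by
  have h := (firstOrder_one_add_u_pow (φ := φ) (n + 1)).of_norm_le_mul
    (Z := fun ω => (φ.F ω).dot (x ω) (y ω) - inner ℝ (x ω) (y ω))
    (hx.norm.mul hy.norm) (.of_forall fun ω => ?_)
  · simpa using h
  · refine ((φ.F ω).abs_dot_sub_le (φ.u_nonneg ω) hn _ _).trans ?_
    exact mul_le_mul (le_abs_self _) (le_abs_self _) (by positivity) (abs_nonneg _)

theorem firstOrder_matVec (hn : 0 < n) (A : Matrix (Fin m) (Fin n) ℝ)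
    {x : Ω → EuclideanSpace ℝ (Fin n)} {x₀ : EuclideanSpace ℝ (Fin n)}
    (hx : Tendsto x φ.l (𝓝 x₀)) :
    φ.FirstOrder ((n + 1) * (m * ‖A‖ * ‖x₀‖))
      (fun ω => (φ.F ω).matVec A (x ω) - eucMulVec A (x ω)) := by
  have h := (firstOrder_one_add_u_pow (φ := φ) (n + 1)).of_norm_le_mul
    (Z := fun ω => (φ.F ω).matVec A (x ω) - eucMulVec A (x ω))
    (hx.norm.const_mul (m * ‖A‖)) (.of_forall fun ω => ?_)
  · simpa using h
  · refine ((φ.F ω).norm_matVec_sub_le (φ.u_nonneg ω) hn A _).trans ?_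
    exact mul_le_mul (le_abs_self _) (le_abs_self _) (by positivity) (abs_nonneg _)

theorem firstOrder_vecScale {c : Ω → ℝ} {x : Ω → EuclideanSpace ℝ (Fin n)} {c₀ : ℝ}
    {x₀ : EuclideanSpace ℝ (Fin n)} (hc : Tendsto c φ.l (𝓝 c₀)) (hx : Tendsto x φ.l (𝓝 x₀)) :
    φ.FirstOrder ‖c₀ • x₀‖ (fun ω => (φ.F ω).vecScale (c ω) (x ω) - c ω • x ω) :=
  firstOrder_of_le_u_mul (hc.smul hx)
    (.of_forall fun ω => (φ.F ω).norm_vecScale_sub_le (φ.u_nonneg ω) _ _)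

theorem firstOrder_vecSub {x y : Ω → EuclideanSpace ℝ (Fin n)}
    {x₀ y₀ : EuclideanSpace ℝ (Fin n)} (hx : Tendsto x φ.l (𝓝 x₀)) (hy : Tendsto y φ.l (𝓝 y₀)) :
    φ.FirstOrder ‖x₀ - y₀‖ (fun ω => (φ.F ω).vecSub (x ω) (y ω) - (x ω - y ω)) :=
  firstOrder_of_le_u_mul (hx.sub hy)
    (.of_forall fun ω => (φ.F ω).norm_vecSub_sub_le (φ.u_nonneg ω) _ _)

theorem firstOrder_vecNorm (hn : 0 < n) {x : Ω → EuclideanSpace ℝ (Fin n)}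
    {x₀ : EuclideanSpace ℝ (Fin n)} (hx : Tendsto x φ.l (𝓝 x₀)) (hx₀ : x₀ ≠ 0) :
    φ.FirstOrder ((n + 2) * ‖x₀‖) (fun ω => (φ.F ω).vecNorm (x ω) - ‖x ω‖) := by
  have hpos : 0 < ‖x₀‖ := norm_pos_iff.2 hx₀
  have hd := firstOrder_dot hn hx hx
  have hdt : Tendsto (fun ω => (φ.F ω).dot (x ω) (x ω)) φ.l (𝓝 (inner ℝ x₀ x₀)) :=
    hd.tendsto (hx.inner hx)
  rw [real_inner_self_eq_norm_sq] at hdt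
  have hdpos : ∀ᶠ ω in φ.l, 0 < (φ.F ω).dot (x ω) (x ω) :=
    hdt.eventually_const_lt (by positivity)
  have hxpos : ∀ᶠ ω in φ.l, 0 < ‖x ω‖ := hx.norm.eventually_const_lt hpos
  have hsq : Tendsto (fun ω => √((φ.F ω).dot (x ω) (x ω))) φ.l (𝓝 ‖x₀‖) := by
    simpa using hdt.sqrt
  have h1 : φ.FirstOrder ((n + 1) * ‖x₀‖)
      (fun ω => √((φ.F ω).dot (x ω) (x ω)) - ‖x ω‖) := by
    have := hd.of_norm_le_mul (Z := fun ω => √((φ.F ω).dot (x ω) (x ω)) - ‖x ω‖)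
      (hx.norm.inv₀ hpos.ne') ?_
    · refine this.mono (le_of_eq ?_)
      rw [norm_inv, norm_norm]
      field_simp
    · filter_upwards [hdpos, hxpos] with ω h1 h2
      -- `√d - N = (d - N²) / (√d + N)`
      have e : (√((φ.F ω).dot (x ω) (x ω)) - ‖x ω‖) * (√((φ.F ω).dot (x ω) (x ω)) + ‖x ω‖) =
          (φ.F ω).dot (x ω) (x ω) - inner ℝ (x ω) (x ω) := by
        rw [real_inner_self_eq_norm_sq]
        nlinarith [Real.sq_sqrt h1.le]
      rw [← e, norm_mul, norm_inv, norm_norm, mul_assoc]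
      refine le_mul_of_one_le_right (norm_nonneg _) ?_
      rw [← div_eq_mul_inv, one_le_div h2]
      exact (le_add_of_nonneg_left (Real.sqrt_nonneg _)).trans (le_abs_self _)
  have h2 : φ.FirstOrder ‖x₀‖
      (fun ω => (φ.F ω).vecNorm (x ω) - √((φ.F ω).dot (x ω) (x ω))) := by
    have := firstOrder_of_le_u_mul
      (Z := fun ω => (φ.F ω).vecNorm (x ω) - √((φ.F ω).dot (x ω) (x ω))) hsq ?_
    · simpa using this
    · filter_upwards [hdpos] with ω h1
      obtain ⟨ε, hε, h⟩ := (φ.F ω).flSqrt_spec _ h1.le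
      have : (φ.F ω).vecNorm (x ω) - √((φ.F ω).dot (x ω) (x ω)) =
          ε * √((φ.F ω).dot (x ω) (x ω)) := by
        rw [FloatArith.vecNorm, h]; ring
      rw [this, norm_mul]
      exact mul_le_mul_of_nonneg_right hε (norm_nonneg _)
  have h3 := h2.add h1
  simp only [sub_add_sub_cancel] at h3
  exact h3.mono (by linarith)

theorem firstOrder_vecDiv {x : Ω → EuclideanSpace ℝ (Fin n)} {c : Ω → ℝ}
    {x₀ : EuclideanSpace ℝ (Fin n)} {c₀ : ℝ} (hx : Tendsto x φ.l (𝓝 x₀))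
    (hc : Tendsto c φ.l (𝓝 c₀)) (hc₀ : c₀ ≠ 0) :
    φ.FirstOrder ‖c₀⁻¹ • x₀‖ (fun ω => (φ.F ω).vecDiv (x ω) (c ω) - (c ω)⁻¹ • x ω) := by
  refine firstOrder_of_le_u_mul ((hc.inv₀ hc₀).smul hx) ?_
  filter_upwards [hc.eventually_ne hc₀] with ω h
  exact (φ.F ω).norm_vecDiv_sub_le (φ.u_nonneg ω) _ h

/-- Computed normalization of a vector with nonzero limit: the computed norm is a nearly correct
scaling factor and the computed quotient is nearly a unit vector, both with relative errors that
depend on the dimension only. -/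
theorem firstOrder_normalize (hn : 0 < n) {s w : Ω → EuclideanSpace ℝ (Fin n)} {γ : Ω → ℝ}
    {s₀ : EuclideanSpace ℝ (Fin n)} (hs : Tendsto s φ.l (𝓝 s₀)) (hs₀ : s₀ ≠ 0)
    (hγ : ∀ ω, γ ω = (φ.F ω).vecNorm (s ω)) (hw : ∀ ω, w ω = (φ.F ω).vecDiv (s ω) (γ ω)) :
    Tendsto γ φ.l (𝓝 ‖s₀‖) ∧ Tendsto w φ.l (𝓝 (‖s₀‖⁻¹ • s₀)) ∧
      φ.FirstOrder ‖s₀‖ (fun ω => γ ω • w ω - s ω) ∧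
      φ.FirstOrder (2 * (n + 3)) (fun ω => inner ℝ (w ω) (w ω) - 1) := by
  have hpos : 0 < ‖s₀‖ := norm_pos_iff.2 hs₀
  have hunit : ‖(‖s₀‖⁻¹ • s₀)‖ = 1 := by
    rw [norm_smul, norm_inv, norm_norm, inv_mul_cancel₀ hpos.ne']
  obtain rfl : γ = fun ω => (φ.F ω).vecNorm (s ω) := funext hγ
  have h1 := firstOrder_vecNorm hn hs hs₀
  have hγt : Tendsto (fun ω => (φ.F ω).vecNorm (s ω)) φ.l (𝓝 ‖s₀‖) := h1.tendsto hs.norm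
  set γ := fun ω => (φ.F ω).vecNorm (s ω)
  obtain rfl : w = fun ω => (φ.F ω).vecDiv (s ω) (γ ω) := funext hw
  have h2 := firstOrder_vecDiv hs hγt hpos.ne'
  have hwt : Tendsto (fun ω => (φ.F ω).vecDiv (s ω) (γ ω)) φ.l (𝓝 (‖s₀‖⁻¹ • s₀)) :=
    h2.tendsto ((hγt.inv₀ hpos.ne').smul hs)
  set w := fun ω => (φ.F ω).vecDiv (s ω) (γ ω)
  rw [hunit] at h2
  have hne : ∀ᶠ ω in φ.l, γ ω ≠ 0 := hγt.eventually_ne hpos.ne'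
  have h3 : φ.FirstOrder ‖s₀‖ (fun ω => γ ω • w ω - s ω) := by
    have := h2.of_norm_le_mul (Z := fun ω => γ ω • w ω - s ω) hγt ?_
    · simpa using this
    · filter_upwards [hne] with ω h
      have : γ ω • w ω - s ω = γ ω • (w ω - (γ ω)⁻¹ • s ω) := by
        rw [smul_sub, smul_inv_smul₀ h]
      rw [this, norm_smul, mul_comm]
  refine ⟨hγt, hwt, h3, ?_⟩
  have h4 : φ.FirstOrder (‖s₀‖ + (n + 2) * ‖s₀‖) (fun ω => ‖γ ω • w ω - s ω‖ + |γ ω - ‖s ω‖|) :=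
    h3.norm.add h1.norm
  have h5 := h4.of_norm_le_mul (Z := fun ω => inner ℝ (w ω) (w ω) - (1 : ℝ))
    ((hγt.inv₀ hpos.ne').mul (hwt.norm.add_const 1)) ?_
  · refine h5.mono (le_of_eq ?_)
    rw [hunit, norm_mul, norm_inv, norm_norm, Real.norm_of_nonneg (by norm_num)]
    field_simp
    ring
  · filter_upwards [hγt.eventually_const_lt hpos] with ω h
    have e : inner ℝ (w ω) (w ω) - 1 =
        (γ ω * (‖w ω‖ - 1)) * ((γ ω)⁻¹ * (‖w ω‖ + 1)) := by
      rw [real_inner_self_eq_norm_sq]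
      field_simp
      ring
    rw [e, norm_mul]
    refine mul_le_mul_of_nonneg_right ?_ (norm_nonneg _)
    have e2 : γ ω * (‖w ω‖ - 1) = (‖γ ω • w ω‖ - ‖s ω‖) + (‖s ω‖ - γ ω) := by
      rw [norm_smul, Real.norm_of_nonneg h.le]; ring
    rw [e2]
    refine (norm_add_le _ _).trans (le_trans (add_le_add (abs_norm_sub_norm_le _ _) ?_)
      (le_abs_self _))
    rw [Real.norm_eq_abs, abs_sub_comm]

end FloatFamily

/-! ### Gram–Schmidt sweeps -/

theorem FloatArith.gsPass_range'_succ {u : ℝ} (F : FloatArith u) {n : ℕ} (g : GramSchmidtKind)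
    (w : ℕ → EuclideanSpace ℝ (Fin n)) (z : EuclideanSpace ℝ (Fin n)) (t : ℕ) :
    F.gsPass g ((List.range' 1 (t + 1)).map w) z =
      F.vecSub (F.gsPass g ((List.range' 1 t).map w) z)
        (F.vecScale (F.dot (w (t + 1))
          (match g with
            | .classical => z
            | .modified => F.gsPass g ((List.range' 1 t).map w) z)) (w (t + 1))) := by
  cases g <;> simp [FloatArith.gsPass, List.range'_concat, add_comm]

namespace FloatFamily

variable {Ω : Type*} {φ : FloatFamily Ω} {n : ℕ}

/-- One computed projection step, for a vector `v` whose limit is orthogonal to the limit of the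
unit vector `w`: its rounding error is relative to the limit of `v`, because the computed
coefficient tends to zero. -/
theorem firstOrder_projStep (hn : 0 < n) {v z w : Ω → EuclideanSpace ℝ (Fin n)}
    {s₀ w₀ : EuclideanSpace ℝ (Fin n)} (hv : Tendsto v φ.l (𝓝 s₀)) (hz : Tendsto z φ.l (𝓝 s₀))
    (hw : Tendsto w φ.l (𝓝 w₀)) (hw₀ : ‖w₀‖ = 1) (horth : inner ℝ w₀ s₀ = 0) :
    φ.FirstOrder ((n + 2) * ‖s₀‖)
      (fun ω => (φ.F ω).vecSub (v ω) ((φ.F ω).vecScale ((φ.F ω).dot (w ω) (z ω)) (w ω)) -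
        (v ω - (inner ℝ (w ω) (z ω) : ℝ) • w ω)) := by
  have h1 := firstOrder_dot hn hw hz
  have hdot : Tendsto (fun ω => (φ.F ω).dot (w ω) (z ω)) φ.l (𝓝 0) := by
    rw [← horth]
    exact h1.tendsto (hw.inner hz)
  have h2 := firstOrder_vecScale hdot hw
  have hscale := h2.tendsto (hdot.smul hw)
  have h3 := firstOrder_vecSub hv hscale
  have h := (h3.sub h2).sub (h1.smul_vec hw)
  simp only [zero_smul, sub_zero, norm_zero, add_zero, hw₀, one_mul, mul_one] at h
  refine h.congr (by linarith) fun ω => ?_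
  rw [sub_smul]
  abel

/-- One computed Gram–Schmidt sweep over the first `t` of the nearly orthonormal vectors
`w 1, …, w j`, applied to a vector `z` whose limit `s₀` is orthogonal to their limits, and whose
inner products with them are `O(u)`. The sweep changes `z` by `O(u)`; after it, the components along
the vectors already treated are bounded by a multiple of `u ‖s₀‖` that does not involve `H`; and
nothing beyond rounding errors is added along directions `y` which are orthogonal to these vectors
in the limit. -/
theorem firstOrder_gsPass (hn : 0 < n) (g : GramSchmidtKind) {j : ℕ}
    {w : ℕ → Ω → EuclideanSpace ℝ (Fin n)} {w₀ : ℕ → EuclideanSpace ℝ (Fin n)}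
    {z : Ω → EuclideanSpace ℝ (Fin n)} {s₀ : EuclideanSpace ℝ (Fin n)} {H : ℝ}
    (hw : ∀ i, 1 ≤ i → i ≤ j → Tendsto (w i) φ.l (𝓝 (w₀ i)))
    (hw₀ : ∀ i l, 1 ≤ i → i ≤ j → 1 ≤ l → l ≤ j →
      inner ℝ (w₀ i) (w₀ l) = if i = l then (1 : ℝ) else 0)
    (hz : Tendsto z φ.l (𝓝 s₀)) (horth : ∀ i, 1 ≤ i → i ≤ j → inner ℝ (w₀ i) s₀ = (0 : ℝ))
    (hzw : ∀ i, 1 ≤ i → i ≤ j → φ.FirstOrder H (fun ω => inner ℝ (w i ω) (z ω)))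
    (t : ℕ) (ht : t ≤ j) :
    φ.FirstOrder (t * (H + j * ((n + 2) * ‖s₀‖)))
      (fun ω => (φ.F ω).gsPass g ((List.range' 1 t).map (w · ω)) (z ω) - z ω) ∧
    (∀ i, 1 ≤ i → i ≤ t → φ.FirstOrder (t * ((n + 2) * ‖s₀‖))
      (fun ω => inner ℝ (w i ω) ((φ.F ω).gsPass g ((List.range' 1 t).map (w · ω)) (z ω)))) ∧
    (∀ (y : Ω → EuclideanSpace ℝ (Fin n)) (y₀ : EuclideanSpace ℝ (Fin n)),
      Tendsto y φ.l (𝓝 y₀) → ‖y₀‖ ≤ 1 → (∀ i, 1 ≤ i → i ≤ t → inner ℝ (w₀ i) y₀ = (0 : ℝ)) →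
      φ.FirstOrder (t * ((n + 2) * ‖s₀‖)) (fun ω =>
        inner ℝ (y ω) ((φ.F ω).gsPass g ((List.range' 1 t).map (w · ω)) (z ω) - z ω))) := by
  have hnorm : ∀ i, 1 ≤ i → i ≤ j → ‖w₀ i‖ = 1 := fun i h1 h2 => by
    have := hw₀ i i h1 h2 h1 h2
    rw [if_pos rfl, real_inner_self_eq_norm_sq] at this
    nlinarith [norm_nonneg (w₀ i)]
  set D : ℝ := (n + 2) * ‖s₀‖ with hD
  have hD0 : 0 ≤ D := by positivity
  induction t with
  | zero =>
    have e : ∀ x : EuclideanSpace ℝ (Fin n), ∀ ω,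
        (φ.F ω).gsPass g ((List.range' 1 0).map (w · ω)) x = x := fun x ω => by cases g <;> rfl
    simp only [e, sub_self, Nat.cast_zero, zero_mul, inner_zero_right]
    exact ⟨.zero, fun i h1 h2 => absurd h1 (by omega), fun _ _ _ _ _ => .zero⟩
  | succ t ih =>
    obtain ⟨ha, hb, hc⟩ := ih (by omega)
    obtain ⟨v, hvdef⟩ : ∃ v : Ω → EuclideanSpace ℝ (Fin n), ∀ ω,
        (φ.F ω).gsPass g ((List.range' 1 t).map (w · ω)) (z ω) = v ω := ⟨_, fun _ => rfl⟩
    simp only [hvdef] at ha hb hc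
    have hv : Tendsto v φ.l (𝓝 s₀) := ha.tendsto hz
    have hwt := hw (t + 1) (by omega) ht
    have hw1 := hnorm (t + 1) (by omega) ht
    -- `x` is the vector the coefficient is computed from
    obtain ⟨x, hxv, hstep⟩ : ∃ x : Ω → EuclideanSpace ℝ (Fin n), (x = z ∨ x = v) ∧ ∀ ω,
        (φ.F ω).gsPass g ((List.range' 1 (t + 1)).map (w · ω)) (z ω) =
          (φ.F ω).vecSub (v ω)
            ((φ.F ω).vecScale ((φ.F ω).dot (w (t + 1) ω) (x ω)) (w (t + 1) ω)) := by
      cases g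
      · refine ⟨z, .inl rfl, fun ω => ?_⟩
        rw [← hvdef]
        exact FloatArith.gsPass_range'_succ (φ.F ω) .classical (w · ω) _ _
      · refine ⟨v, .inr rfl, fun ω => ?_⟩
        rw [← hvdef]
        exact FloatArith.gsPass_range'_succ (φ.F ω) .modified (w · ω) _ _
    have hx : Tendsto x φ.l (𝓝 s₀) := by rcases hxv with rfl | rfl <;> assumption
    have hE := firstOrder_projStep hn hv hx hwt hw1 (horth _ (by omega) ht)
    rw [← hD] at hE
    simp only [← hstep] at hE
    clear hstep
    obtain ⟨v', hv'def⟩ : ∃ v' : Ω → EuclideanSpace ℝ (Fin n), ∀ ω,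
        (φ.F ω).gsPass g ((List.range' 1 (t + 1)).map (w · ω)) (z ω) = v' ω := ⟨_, fun _ => rfl⟩
    simp only [hv'def] at hE ⊢
    set h : Ω → ℝ := fun ω => inner ℝ (w (t + 1) ω) (x ω) with hh
    set e : Ω → EuclideanSpace ℝ (Fin n) := fun ω => v' ω - (v ω - h ω • w (t + 1) ω) with he
    have hv'e : ∀ ω, v' ω = v ω - h ω • w (t + 1) ω + e ω := fun ω => by simp [he]
    have hwv : φ.FirstOrder (t * D) (fun ω => inner ℝ (w (t + 1) ω) (v ω - z ω)) :=
      hc _ _ hwt hw1.le fun i h1 h2 => by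
        rw [hw₀ i (t + 1) h1 (by omega) (by omega) ht, if_neg (by omega)]
    have htD : 0 ≤ (t : ℝ) * D := by positivity
    have hhv : φ.FirstOrder (t * D) (fun ω => inner ℝ (w (t + 1) ω) (v ω) - h ω) := by
      rcases hxv with rfl | rfl
      · simpa only [inner_sub_right] using hwv
      · simp only [hh, sub_self]
        exact FirstOrder.zero.mono htD
    have hhO : φ.FirstOrder (H + t * D) h := by
      rcases hxv with rfl | rfl
      · exact (hzw _ (by omega) ht).mono (by linarith)
      · have := (hzw _ (by omega) ht).add hwv
        simpa only [inner_sub_right, add_sub_cancel] using this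
    have htj : (t : ℝ) * D ≤ j * D - D := by
      have : (t : ℝ) + 1 ≤ j := by exact_mod_cast ht
      nlinarith
    refine ⟨?_, fun i h1 h2 => ?_, fun y y₀ hy hy1 hyw => ?_⟩
    · have h1 := (ha.sub (hhO.smul_vec hwt)).add hE
      rw [hw1, mul_one] at h1
      refine h1.congr ?_ fun ω => ?_
      · push_cast; linarith
      · rw [hv'e]; abel
    · have hEi := hE.inner_right (hw i h1 (by omega))
      rw [hnorm i h1 (by omega), mul_one] at hEi
      rcases Nat.lt_or_ge t i with hti | hti
      · obtain rfl : i = t + 1 := by omega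
        have hww : Tendsto (fun ω => 1 - inner ℝ (w (t + 1) ω) (w (t + 1) ω)) φ.l (𝓝 (0 : ℝ)) := by
          have := (hwt.inner (𝕜 := ℝ) hwt).const_sub 1
          simpa [hw1] using this
        have h3 := (hhv.add (hhO.mul hww)).add hEi
        refine h3.congr ?_ fun ω => ?_
        · push_cast; rw [abs_zero]; linarith
        · rw [hv'e, inner_add_right, inner_sub_right, real_inner_smul_right]; ring
      · have hww : Tendsto (fun ω => inner ℝ (w i ω) (w (t + 1) ω)) φ.l (𝓝 (0 : ℝ)) := by
          have := (hw i h1 (by omega)).inner (𝕜 := ℝ) hwt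
          rwa [hw₀ i (t + 1) h1 (by omega) (by omega) ht, if_neg (by omega)] at this
        have h3 := ((hb i h1 hti).sub (hhO.mul hww)).add hEi
        refine h3.congr ?_ fun ω => ?_
        · push_cast; rw [abs_zero]; linarith
        · rw [hv'e, inner_add_right, inner_sub_right, real_inner_smul_right]
    · have hEi := (hE.inner_right hy).mono (mul_le_of_le_one_right hD0 hy1)
      have hww : Tendsto (fun ω => inner ℝ (y ω) (w (t + 1) ω)) φ.l (𝓝 (0 : ℝ)) := by
        have := hy.inner (𝕜 := ℝ) hwt
        rwa [real_inner_comm, hyw (t + 1) (by omega) le_rfl] at this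
      have h3 := ((hc y y₀ hy hy1 fun i h1 h2 => hyw i h1 (by omega)).sub
        (hhO.mul hww)).add hEi
      refine h3.congr ?_ fun ω => ?_
      · push_cast; rw [abs_zero]; linarith
      · rw [hv'e, inner_sub_right, inner_sub_right, inner_add_right, inner_sub_right,
          real_inner_smul_right]; ring

/-- `r` computed Gram–Schmidt sweeps over `w 1, …, w j`; already the first one reduces the
components along these vectors to the level of the rounding errors. -/
theorem firstOrder_reorth (hn : 0 < n) (g : GramSchmidtKind) {j : ℕ}
    {w : ℕ → Ω → EuclideanSpace ℝ (Fin n)} {w₀ : ℕ → EuclideanSpace ℝ (Fin n)}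
    {z : Ω → EuclideanSpace ℝ (Fin n)} {s₀ : EuclideanSpace ℝ (Fin n)} {H : ℝ} (hH : 0 ≤ H)
    (hw : ∀ i, 1 ≤ i → i ≤ j → Tendsto (w i) φ.l (𝓝 (w₀ i)))
    (hw₀ : ∀ i l, 1 ≤ i → i ≤ j → 1 ≤ l → l ≤ j →
      inner ℝ (w₀ i) (w₀ l) = if i = l then (1 : ℝ) else 0)
    (hz : Tendsto z φ.l (𝓝 s₀)) (horth : ∀ i, 1 ≤ i → i ≤ j → inner ℝ (w₀ i) s₀ = (0 : ℝ))
    (hzw : ∀ i, 1 ≤ i → i ≤ j → φ.FirstOrder H (fun ω => inner ℝ (w i ω) (z ω))) (r : ℕ) :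
    φ.FirstOrder (r * (j * (H + 2 * (j * ((n + 2) * ‖s₀‖)))))
      (fun ω => (φ.F ω).reorth g r (w · ω) j (z ω) - z ω) ∧
    (1 ≤ r → ∀ i, 1 ≤ i → i ≤ j → φ.FirstOrder (j * ((n + 2) * ‖s₀‖))
      (fun ω => inner ℝ (w i ω) ((φ.F ω).reorth g r (w · ω) j (z ω)))) ∧
    (∀ (y : Ω → EuclideanSpace ℝ (Fin n)) (y₀ : EuclideanSpace ℝ (Fin n)),
      Tendsto y φ.l (𝓝 y₀) → ‖y₀‖ ≤ 1 → (∀ i, 1 ≤ i → i ≤ j → inner ℝ (w₀ i) y₀ = (0 : ℝ)) →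
      φ.FirstOrder (r * (j * ((n + 2) * ‖s₀‖))) (fun ω =>
        inner ℝ (y ω) ((φ.F ω).reorth g r (w · ω) j (z ω) - z ω))) := by
  set D : ℝ := (n + 2) * ‖s₀‖ with hD
  have hD0 : 0 ≤ D := by positivity
  have hjD : 0 ≤ j * D := by positivity
  induction r with
  | zero =>
    have e : ∀ x : EuclideanSpace ℝ (Fin n), ∀ ω,
        (φ.F ω).reorth g 0 (w · ω) j x = x := fun x ω => rfl
    simp only [e, sub_self, Nat.cast_zero, zero_mul, inner_zero_right]
    exact ⟨.zero, fun h => absurd h (by omega), fun _ _ _ _ _ => .zero⟩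
  | succ r ih =>
    obtain ⟨ha, hb, hc⟩ := ih
    obtain ⟨v, hv⟩ : ∃ v : Ω → EuclideanSpace ℝ (Fin n), ∀ ω,
        (φ.F ω).reorth g r (w · ω) j (z ω) = v ω := ⟨_, fun _ => rfl⟩
    have hstep : ∀ ω, (φ.F ω).reorth g (r + 1) (w · ω) j (z ω) =
        (φ.F ω).gsPass g ((List.range' 1 j).map (w · ω)) (v ω) := fun ω => by
      rw [← hv]
      simp only [FloatArith.reorth, Function.iterate_succ_apply']
    simp only [hv] at ha hb hc
    have hbv : ∀ i, 1 ≤ i → i ≤ j → φ.FirstOrder (H + j * D) (fun ω => inner ℝ (w i ω) (v ω)) := by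
      intro i h1 h2
      rcases Nat.eq_zero_or_pos r with rfl | hr
      · exact (hzw i h1 h2).congr (le_add_of_nonneg_right hjD) fun ω => by rw [← hv]; rfl
      · exact (hb hr i h1 h2).mono (le_add_of_nonneg_left hH)
    obtain ⟨ha', hb', hc'⟩ := firstOrder_gsPass hn g hw hw₀ (ha.tendsto hz) horth
      hbv j le_rfl
    simp only [hstep, ← hD] at ha' hb' hc' ⊢
    refine ⟨?_, fun _ => hb', fun y y₀ hy hy1 hyw => ?_⟩
    · refine (ha'.add ha).congr ?_ fun ω => ?_
      · push_cast; exact le_of_eq (by ring)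
      · abel
    · refine ((hc' y y₀ hy hy1 hyw).add (hc y y₀ hy hy1 hyw)).congr ?_ fun ω => ?_
      · push_cast; exact le_of_eq (by ring)
      · simp only [inner_sub_right]; ring

end FloatFamily

/-! ### The exact bidiagonalization -/

/-- `w 1, …, w j` are orthonormal. -/
def OrthonormalUpTo {E : Type*} [NormedAddCommGroup E] [InnerProductSpace ℝ E] (w : ℕ → E)
    (j : ℕ) : Prop :=
  ∀ i l, 1 ≤ i → i ≤ j → 1 ≤ l → l ≤ j → inner ℝ (w i) (w l) = if i = l then (1 : ℝ) else 0

namespace OrthonormalUpTo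

variable {E : Type*} [NormedAddCommGroup E] [InnerProductSpace ℝ E] {w : ℕ → E} {j : ℕ}

theorem norm_eq_one (h : OrthonormalUpTo w j) {i : ℕ} (h1 : 1 ≤ i) (h2 : i ≤ j) : ‖w i‖ = 1 := by
  have := h i i h1 h2 h1 h2
  rw [if_pos rfl, real_inner_self_eq_norm_sq] at this
  nlinarith [norm_nonneg (w i)]

theorem mono (h : OrthonormalUpTo w j) {j' : ℕ} (hj : j' ≤ j) : OrthonormalUpTo w j' :=
  fun i l h1 h2 h3 h4 => h i l h1 (h2.trans hj) h3 (h4.trans hj)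

theorem succ (h : OrthonormalUpTo w j) (h1 : ‖w (j + 1)‖ = 1)
    (h0 : ∀ i, 1 ≤ i → i ≤ j → inner ℝ (w i) (w (j + 1)) = (0 : ℝ)) :
    OrthonormalUpTo w (j + 1) := by
  intro i l hi hij hl hlj
  rcases Nat.lt_or_ge j i with hi' | hi'
  · obtain rfl : i = j + 1 := by omega
    rcases Nat.lt_or_ge j l with hl' | hl'
    · obtain rfl : l = j + 1 := by omega
      rw [if_pos rfl, real_inner_self_eq_norm_sq, h1, one_pow]
    · rw [if_neg (by omega), real_inner_comm, h0 l hl hl']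
  · rcases Nat.lt_or_ge j l with hl' | hl'
    · obtain rfl : l = j + 1 := by omega
      rw [if_neg (by omega), h0 i hi hi']
    · exact h i l hi hi' hl hl'

end OrthonormalUpTo

/-- The orthogonality of the Lanczos vectors: `A v j - a j • w j` is orthogonal to `w 1, …, w j` as
soon as the transposed recurrence expresses each `Aᵀ w i` by `v i` and `v (i - 1)`. -/
theorem inner_eucMulVec_sub_eq_zero {m n : ℕ} (A : Matrix (Fin m) (Fin n) ℝ) {j : ℕ} (hj : 1 ≤ j)
    {w : ℕ → EuclideanSpace ℝ (Fin m)} {v : ℕ → EuclideanSpace ℝ (Fin n)} {a b : ℕ → ℝ}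
    (hw : OrthonormalUpTo w j) (hv : OrthonormalUpTo v j)
    (hb : ∀ i, 1 ≤ i → i ≤ j → b i * inner ℝ (v (i - 1)) (v j) = (0 : ℝ))
    (hA : ∀ i, 1 ≤ i → i ≤ j → eucMulVec A.transpose (w i) = a i • v i + b i • v (i - 1))
    {i : ℕ} (h1 : 1 ≤ i) (h2 : i ≤ j) :
    inner ℝ (w i) (eucMulVec A (v j) - a j • w j) = (0 : ℝ) := by
  rw [inner_sub_right, real_inner_comm, inner_eucMulVec_left, hA i h1 h2, inner_add_right,
    real_inner_smul_right, real_inner_smul_right, real_inner_smul_right,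
    real_inner_comm (v (i - 1)), hb i h1 h2, hw i j h1 h2 hj le_rfl, hv j i hj le_rfl h1 h2]
  rcases eq_or_ne i j with rfl | hij
  · simp
  · simp [hij, hij.symm]

theorem le_of_inner_eucMulVec {m n : ℕ} (A : Matrix (Fin m) (Fin n) ℝ)
    {x : EuclideanSpace ℝ (Fin m)} {y : EuclideanSpace ℝ (Fin n)} (hx : ‖x‖ = 1) (hy : ‖y‖ = 1) :
    inner ℝ x (eucMulVec A y) ≤ ‖A‖ := by
  refine (real_inner_le_norm _ _).trans ?_
  have := norm_eucMulVec_le A y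
  rw [hx, one_mul]
  simpa [hy] using this

namespace IsLanczosBidiag

variable {m n : ℕ} {A : Matrix (Fin m) (Fin n) ℝ} {b : EuclideanSpace ℝ (Fin m)} {k : ℕ}
  {p : ℕ → EuclideanSpace ℝ (Fin m)} {q : ℕ → EuclideanSpace ℝ (Fin n)} {α β : ℕ → ℝ}

theorem alpha_pos (h : IsLanczosBidiag A b k p q α β) {j : ℕ} (h1 : 1 ≤ j) (h2 : j ≤ k + 1) :
    0 < α j := by
  refine lt_of_le_of_ne ?_ (h.alpha_ne_zero j h1 h2).symm
  obtain rfl | ⟨i, hi, rfl⟩ : j = 1 ∨ ∃ i, 1 ≤ i ∧ j = i + 1 := by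
    rcases Nat.lt_or_ge 1 j with hj | hj
    · exact .inr ⟨j - 1, by omega, by omega⟩
    · exact .inl (by omega)
  · rw [h.alpha_one]; positivity
  · rw [h.alpha_step i hi (by omega)]; positivity

theorem beta_pos (h : IsLanczosBidiag A b k p q α β) {j : ℕ} (h1 : 1 ≤ j) (h2 : j ≤ k + 1) :
    0 < β j := by
  refine lt_of_le_of_ne ?_ (h.beta_ne_zero j h1 h2).symm
  obtain rfl | ⟨i, hi, rfl⟩ : j = 1 ∨ ∃ i, 1 ≤ i ∧ j = i + 1 := by
    rcases Nat.lt_or_ge 1 j with hj | hj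
    · exact .inr ⟨j - 1, by omega, by omega⟩
    · exact .inl (by omega)
  · rw [h.beta_one]; positivity
  · rw [h.beta_step i hi (by omega)]; positivity

theorem mulVec_eq (h : IsLanczosBidiag A b k p q α β) {j : ℕ} (h1 : 1 ≤ j) (h2 : j ≤ k) :
    eucMulVec A (q j) = α j • p j + β (j + 1) • p (j + 1) := by
  rw [h.p_step j h1 h2, smul_inv_smul₀ (h.beta_ne_zero _ (by omega) (by omega))]
  abel

theorem transpose_mulVec_eq (h : IsLanczosBidiag A b k p q α β) (hq : q 0 = 0) {j : ℕ}
    (h1 : 1 ≤ j) (h2 : j ≤ k + 1) :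
    eucMulVec A.transpose (p j) = α j • q j + β j • q (j - 1) := by
  obtain rfl | ⟨i, hi, rfl⟩ : j = 1 ∨ ∃ i, 1 ≤ i ∧ j = i + 1 := by
    rcases Nat.lt_or_ge 1 j with hj | hj
    · exact .inr ⟨j - 1, by omega, by omega⟩
    · exact .inl (by omega)
  · rw [h.q_one, smul_inv_smul₀ (h.alpha_ne_zero _ le_rfl (by omega)), Nat.sub_self, hq]
    simp
  · rw [h.q_step i hi (by omega), smul_inv_smul₀ (h.alpha_ne_zero _ (by omega) (by omega)),
      Nat.add_sub_cancel]
    abel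

theorem orthonormal (h : IsLanczosBidiag A b k p q α β) (hq : q 0 = 0) {j : ℕ} (h1 : 1 ≤ j)
    (h2 : j ≤ k + 1) : OrthonormalUpTo p j ∧ OrthonormalUpTo q j := by
  have hnorm : ∀ {N : ℕ} {c : ℝ} {s : EuclideanSpace ℝ (Fin N)}, c = ‖s‖ → c ≠ 0 →
      ‖c⁻¹ • s‖ = 1 := fun hc h0 => by
    rw [norm_smul, norm_inv, ← hc, hc, norm_norm, inv_mul_cancel₀ (hc ▸ h0)]
  induction j, h1 using Nat.le_induction with
  | base =>
    have e : ∀ {N : ℕ} (w : ℕ → EuclideanSpace ℝ (Fin N)), OrthonormalUpTo w 0 :=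
      fun w i l h1 h2 => by omega
    refine ⟨(e p).succ ?_ fun i _ _ => by omega, (e q).succ ?_ fun i _ _ => by omega⟩
    · rw [h.p_one]
      exact hnorm h.beta_one (h.beta_ne_zero 1 le_rfl (by omega))
    · rw [h.q_one]
      exact hnorm h.alpha_one (h.alpha_ne_zero 1 le_rfl (by omega))
  | succ j h1 ih =>
    obtain ⟨hp, hqo⟩ := ih (by omega)
    have hp' : OrthonormalUpTo p (j + 1) := by
      refine hp.succ ?_ fun i hi hij => ?_
      · rw [h.p_step j h1 (by omega)]
        exact hnorm (h.beta_step j h1 (by omega)) (h.beta_ne_zero _ (by omega) (by omega))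
      · rw [h.p_step j h1 (by omega), real_inner_smul_right,
          inner_eucMulVec_sub_eq_zero A (b := β) h1 hp hqo (fun i hi hij => ?_)
            (fun i hi hij => h.transpose_mulVec_eq hq hi (by omega)) hi hij, mul_zero]
        rcases Nat.lt_or_ge 1 i with hi1 | hi1
        · rw [hqo (i - 1) j (by omega) (by omega) h1 le_rfl, if_neg (by omega), mul_zero]
        · obtain rfl : i = 1 := by omega
          rw [Nat.sub_self, hq, inner_zero_left, mul_zero]
    refine ⟨hp', hqo.succ ?_ fun i hi hij => ?_⟩
    · rw [h.q_step j h1 (by omega)]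
      exact hnorm (h.alpha_step j h1 (by omega)) (h.alpha_ne_zero _ (by omega) (by omega))
    · have hv : OrthonormalUpTo (fun i => p (i + 1)) j := fun i l hi hij hl hlj => by
        simpa using hp' (i + 1) (l + 1) (by omega) (by omega) (by omega) (by omega)
      rw [h.q_step j h1 (by omega), real_inner_smul_right,
        inner_eucMulVec_sub_eq_zero A.transpose (v := fun i => p (i + 1)) (a := fun i => β (i + 1))
          (b := α) h1 hqo hv (fun i hi hij => ?_) (fun i hi hij => ?_) hi hij, mul_zero]
      · rw [Nat.sub_add_cancel hi, hp' i (j + 1) hi (by omega) (by omega) le_rfl,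
          if_neg (by omega), mul_zero]
      · beta_reduce
        rw [Matrix.transpose_transpose, Nat.sub_add_cancel hi, h.mulVec_eq hi (by omega), add_comm]

theorem alpha_le (h : IsLanczosBidiag A b k p q α β) (hq : q 0 = 0) {j : ℕ} (h1 : 1 ≤ j)
    (h2 : j ≤ k + 1) : α j ≤ ‖A‖ := by
  obtain ⟨hp, hqo⟩ := h.orthonormal hq h1 h2
  have := le_of_inner_eucMulVec A.transpose (hqo.norm_eq_one h1 le_rfl) (hp.norm_eq_one h1 le_rfl)
  rw [norm_transpose_eq, h.transpose_mulVec_eq hq h1 h2, inner_add_right, real_inner_smul_right,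
    real_inner_smul_right, hqo j j h1 le_rfl h1 le_rfl, if_pos rfl] at this
  rcases Nat.lt_or_ge 1 j with hj | hj
  · rw [hqo j (j - 1) h1 le_rfl (by omega) (by omega), if_neg (by omega)] at this
    linarith
  · obtain rfl : j = 1 := by omega
    rw [Nat.sub_self, hq, inner_zero_right] at this
    linarith

theorem beta_succ_le (h : IsLanczosBidiag A b k p q α β) (hq : q 0 = 0) {j : ℕ} (h1 : 1 ≤ j)
    (h2 : j ≤ k) : β (j + 1) ≤ ‖A‖ := by
  obtain ⟨hp, hqo⟩ := h.orthonormal hq (j := j + 1) (by omega) (by omega)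
  have := le_of_inner_eucMulVec A (hp.norm_eq_one (i := j + 1) (by omega) le_rfl)
    (hqo.norm_eq_one h1 (by omega))
  rw [h.mulVec_eq h1 h2, inner_add_right, real_inner_smul_right, real_inner_smul_right,
    hp (j + 1) (j + 1) (by omega) le_rfl (by omega) le_rfl, if_pos rfl,
    hp (j + 1) j (by omega) le_rfl (by omega) (by omega), if_neg (by omega)] at this
  linarith

end IsLanczosBidiag

/-! ### Local errors of the computed bidiagonalization -/

namespace FloatFamily

variable {Ω : Type*} {φ : FloatFamily Ω} {m n : ℕ}

/-- First-order description of one of the two computed sequences of Lanczos vectors up to index `j`.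
The vectors `w i` and the normalization factors `γ i` converge to the exact ones; the vectors are
orthonormal up to `2 N² u`; for `i₀ ≤ i`, the residual `d i` of the recurrence defining `w i` is
bounded by a multiple of `N³ κ u`. The last field is a bound on components of `d i` orthogonal to
the vectors that `w i` was reorthogonalized against. It does not contain the contribution of the
reorthogonalization, so that the constants do not grow from one step to the next. -/
structure NearlyLanczos (φ : FloatFamily Ω) (N κ : ℝ) (r i₀ : ℕ)
    (w : ℕ → Ω → EuclideanSpace ℝ (Fin m)) (w₀ : ℕ → EuclideanSpace ℝ (Fin m))
    (γ : ℕ → Ω → ℝ) (γ₀ : ℕ → ℝ) (d : ℕ → Ω → EuclideanSpace ℝ (Fin m)) (j : ℕ) : Prop where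
  tendsto_vec : ∀ i, 1 ≤ i → i ≤ j → Tendsto (w i) φ.l (𝓝 (w₀ i))
  tendsto_coef : ∀ i, 1 ≤ i → i ≤ j → Tendsto (γ i) φ.l (𝓝 (γ₀ i))
  orth : ∀ i l, 1 ≤ i → i ≤ j → 1 ≤ l → l ≤ j →
    φ.FirstOrder (2 * N ^ 2) (fun ω => inner ℝ (w i ω) (w l ω) - if i = l then (1 : ℝ) else 0)
  residual : ∀ i, i₀ ≤ i → 1 ≤ i → i ≤ j →
    φ.FirstOrder ((r * (r + 13) + 3) * N ^ 3 * κ) (d i)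
  residual_inner : ∀ i, i₀ ≤ i → 1 ≤ i → i ≤ j →
    ∀ (y : Ω → EuclideanSpace ℝ (Fin m)) (y₀ : EuclideanSpace ℝ (Fin m)),
      Tendsto y φ.l (𝓝 y₀) → ‖y₀‖ ≤ 1 → (∀ l, 1 ≤ l → l < i → inner ℝ (w₀ l) y₀ = (0 : ℝ)) →
      φ.FirstOrder ((r + 3) * N ^ 2 * κ) (fun ω => inner ℝ (y ω) (d i ω))

theorem NearlyLanczos.succ {N κ : ℝ} {r i₀ : ℕ} {w : ℕ → Ω → EuclideanSpace ℝ (Fin m)}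
    {w₀ : ℕ → EuclideanSpace ℝ (Fin m)} {γ : ℕ → Ω → ℝ} {γ₀ : ℕ → ℝ}
    {d : ℕ → Ω → EuclideanSpace ℝ (Fin m)} {j : ℕ} (h : NearlyLanczos φ N κ r i₀ w w₀ γ γ₀ d j)
    (hw : Tendsto (w (j + 1)) φ.l (𝓝 (w₀ (j + 1))))
    (hγ : Tendsto (γ (j + 1)) φ.l (𝓝 (γ₀ (j + 1))))
    (hnorm : φ.FirstOrder (2 * N ^ 2) (fun ω => inner ℝ (w (j + 1) ω) (w (j + 1) ω) - (1 : ℝ)))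
    (horth : ∀ i, 1 ≤ i → i ≤ j →
      φ.FirstOrder (2 * N ^ 2) (fun ω => (inner ℝ (w i ω) (w (j + 1) ω) : ℝ)))
    (hd : i₀ ≤ j + 1 → φ.FirstOrder ((r * (r + 13) + 3) * N ^ 3 * κ) (d (j + 1)))
    (hdi : i₀ ≤ j + 1 → ∀ (y : Ω → EuclideanSpace ℝ (Fin m)) (y₀ : EuclideanSpace ℝ (Fin m)),
      Tendsto y φ.l (𝓝 y₀) → ‖y₀‖ ≤ 1 → (∀ l, 1 ≤ l → l < j + 1 → inner ℝ (w₀ l) y₀ = (0 : ℝ)) →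
      φ.FirstOrder ((r + 3) * N ^ 2 * κ) (fun ω => inner ℝ (y ω) (d (j + 1) ω))) :
    NearlyLanczos φ N κ r i₀ w w₀ γ γ₀ d (j + 1) := by
  have key : ∀ i, i ≤ j + 1 → i ≤ j ∨ i = j + 1 := fun i hi => by omega
  refine ⟨fun i h1 h2 => ?_, fun i h1 h2 => ?_, fun i l h1 h2 h3 h4 => ?_, fun i h0 h1 h2 => ?_,
    fun i h0 h1 h2 => ?_⟩
  · rcases key i h2 with h2 | rfl
    exacts [h.tendsto_vec i h1 h2, hw]
  · rcases key i h2 with h2 | rfl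
    exacts [h.tendsto_coef i h1 h2, hγ]
  · rcases key i h2 with h2 | rfl <;> rcases key l h4 with h4 | rfl
    · exact h.orth i l h1 h2 h3 h4
    · simpa only [if_neg (show i ≠ j + 1 by omega), sub_zero] using horth i h1 h2
    · simpa only [if_neg (show j + 1 ≠ l by omega), sub_zero, real_inner_comm] using horth l h3 h4
    · simpa using hnorm
  · rcases key i h2 with h2 | rfl
    exacts [h.residual i h0 h1 h2, hd h0]
  · rcases key i h2 with h2 | rfl
    exacts [h.residual_inner i h0 h1 h2, hdi h0]

/-- One step of the computed recurrence: `w (j + 1)` is obtained by normalizing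
`A v j - a j • w j` after reorthogonalization against `w 1, …, w j`. The step is applied to `A` and
to its transpose in turn; what is needed about the other sequence `v` is its orthonormality and that
the residuals of the recurrence for `Aᵀ w i` have small components along `v j`. -/
theorem NearlyLanczos.step (hm : 0 < m) (hn : 0 < n) (A : Matrix (Fin m) (Fin n) ℝ)
    (g : GramSchmidtKind) {r : ℕ} (hr : 1 ≤ r) {N : ℝ} (hmnN : (m : ℝ) + n + 1 ≤ N)
    {j i₀ : ℕ} (hj : 1 ≤ j) (hjN : (j : ℝ) ≤ N)
    {w : ℕ → Ω → EuclideanSpace ℝ (Fin m)} {w₀ : ℕ → EuclideanSpace ℝ (Fin m)}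
    {γ : ℕ → Ω → ℝ} {γ₀ : ℕ → ℝ} {d : ℕ → Ω → EuclideanSpace ℝ (Fin m)}
    (hW : NearlyLanczos φ N ‖A‖ r i₀ w w₀ γ γ₀ d j) (hw₀ : OrthonormalUpTo w₀ j)
    {v : ℕ → Ω → EuclideanSpace ℝ (Fin n)} {v₀ : EuclideanSpace ℝ (Fin n)}
    {a b : ℕ → Ω → ℝ} {a₀ : ℕ → ℝ}
    (hv : Tendsto (v j) φ.l (𝓝 v₀)) (hv₀ : ‖v₀‖ = 1)
    (ha : ∀ i, 1 ≤ i → i ≤ j → Tendsto (a i) φ.l (𝓝 (a₀ i)))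
    (ha₀ : ∀ i, 1 ≤ i → i ≤ j → |a₀ i| ≤ ‖A‖)
    (horth : ∀ i, 1 ≤ i → i ≤ j → inner ℝ (w₀ i) (eucMulVec A v₀ - a₀ j • w₀ j) = (0 : ℝ))
    (hγ₀ : γ₀ (j + 1) = ‖eucMulVec A v₀ - a₀ j • w₀ j‖) (hγ₀' : γ₀ (j + 1) ≠ 0)
    (hw₀' : w₀ (j + 1) = (γ₀ (j + 1))⁻¹ • (eucMulVec A v₀ - a₀ j • w₀ j))
    (hvv : ∀ i, 1 ≤ i → i ≤ j →
      φ.FirstOrder (2 * N ^ 2) (fun ω => inner ℝ (v i ω) (v j ω) - if i = j then (1 : ℝ) else 0))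
    (hbv : ∀ i, 1 ≤ i → i ≤ j →
      φ.FirstOrder (2 * N ^ 2 * ‖A‖) (fun ω => b i ω * inner ℝ (v (i - 1) ω) (v j ω)))
    (hd : ∀ i, 1 ≤ i → i ≤ j → φ.FirstOrder ((r + 3) * N ^ 2 * ‖A‖) (fun ω =>
      inner ℝ (v j ω) (a i ω • v i ω + b i ω • v (i - 1) ω - eucMulVec A.transpose (w i ω))))
    {s : Ω → EuclideanSpace ℝ (Fin m)}
    (hs : ∀ ω, s ω = (φ.F ω).reorth g r (w · ω) j ((φ.F ω).vecSub ((φ.F ω).matVec A (v j ω))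
      ((φ.F ω).vecScale (a j ω) (w j ω))))
    (hγ : ∀ ω, γ (j + 1) ω = (φ.F ω).vecNorm (s ω))
    (hw : ∀ ω, w (j + 1) ω = (φ.F ω).vecDiv (s ω) (γ (j + 1) ω))
    (hd' : ∀ ω, d (j + 1) ω = γ (j + 1) ω • w (j + 1) ω -
      (eucMulVec A (v j ω) - a j ω • w j ω)) :
    NearlyLanczos φ N ‖A‖ r i₀ w w₀ γ γ₀ d (j + 1) := by
  have hm1 : (1 : ℝ) ≤ m := by exact_mod_cast hm
  have hn1 : (1 : ℝ) ≤ n := by exact_mod_cast hn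
  have hj1 : (1 : ℝ) ≤ j := by exact_mod_cast hj
  have hN : 3 ≤ N := by linarith
  set κ := ‖A‖ with hκ
  have hκ0 : 0 ≤ κ := norm_nonneg A
  have hN9 : 9 ≤ N ^ 2 := by nlinarith
  have hNκ : 9 * κ ≤ N ^ 2 * κ := mul_le_mul_of_nonneg_right hN9 hκ0
  set s₀ := eucMulVec A v₀ - a₀ j • w₀ j with hs₀
  have hwj := hW.tendsto_vec j hj le_rfl
  have hwj1 : ‖w₀ j‖ = 1 := hw₀.norm_eq_one hj le_rfl
  have haj := ha j hj le_rfl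
  have hs₀ne : s₀ ≠ 0 := by
    rw [hγ₀] at hγ₀'
    exact norm_ne_zero_iff.1 hγ₀'
  have hσpos : 0 < ‖s₀‖ := norm_pos_iff.2 hs₀ne
  -- `s₀` is the part of `A v₀` orthogonal to `w₀ j`
  have hσκ : ‖s₀‖ ≤ κ := by
    have h1 : inner ℝ s₀ s₀ = (inner ℝ s₀ (eucMulVec A v₀) : ℝ) := by
      conv_lhs => rw [hs₀, inner_sub_right, real_inner_smul_right, ← hs₀]
      rw [real_inner_comm (w₀ j), horth j hj le_rfl, mul_zero, sub_zero]
    rw [real_inner_self_eq_norm_sq] at h1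
    have h2 := real_inner_le_norm s₀ (eucMulVec A v₀)
    have h3 := norm_eucMulVec_le A v₀
    rw [hv₀, mul_one] at h3
    nlinarith
  -- the vector before reorthogonalization
  obtain ⟨z, hz⟩ : ∃ z : Ω → EuclideanSpace ℝ (Fin m), ∀ ω, (φ.F ω).vecSub
      ((φ.F ω).matVec A (v j ω)) ((φ.F ω).vecScale (a j ω) (w j ω)) = z ω := ⟨_, fun _ => rfl⟩
  have hAv : Tendsto (fun ω => eucMulVec A (v j ω)) φ.l (𝓝 (eucMulVec A v₀)) :=
    ((continuous_eucMulVec A).tendsto _).comp hv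
  have hexact : Tendsto (fun ω => eucMulVec A (v j ω) - a j ω • w j ω) φ.l (𝓝 s₀) :=
    hAv.sub (haj.smul hwj)
  have he : φ.FirstOrder (2 * N ^ 2 * κ)
      (fun ω => z ω - (eucMulVec A (v j ω) - a j ω • w j ω)) := by
    have h1 := firstOrder_matVec hn A hv
    have h2 := firstOrder_vecScale haj hwj
    have h3 := firstOrder_vecSub (h1.tendsto hAv) (h2.tendsto (haj.smul hwj))
    rw [norm_smul, hwj1, mul_one] at h2
    rw [hv₀, mul_one, ← hκ] at h1
    refine ((h3.add h1).sub h2).congr ?_ fun ω => ?_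
    · have e1 : ((n : ℝ) + 1) * (m * κ) ≤ N ^ 2 * κ := by
        have : ((n : ℝ) + 1) * m ≤ N ^ 2 := by nlinarith
        nlinarith
      have e2 := ha₀ j hj le_rfl
      rw [Real.norm_eq_abs, ← hs₀]
      linarith
    · rw [hz]; abel
  have hzt : Tendsto z φ.l (𝓝 s₀) := he.tendsto hexact
  have hH : ∀ i, 1 ≤ i → i ≤ j →
      φ.FirstOrder ((r + 11) * N ^ 2 * κ) (fun ω => inner ℝ (w i ω) (z ω)) := by
    intro i h1 h2
    have c1 := he.inner_right (hW.tendsto_vec i h1 h2)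
    rw [hw₀.norm_eq_one h1 h2, mul_one] at c1
    have c2 := (hvv i h1 h2).mul (ha i h1 h2)
    have c3 := (hW.orth i j h1 h2 hj le_rfl).mul haj
    refine ((((c1.add c2).add (hbv i h1 h2)).sub (hd i h1 h2)).sub c3).congr ?_ fun ω => ?_
    · have e1 := mul_le_mul_of_nonneg_left (ha₀ i h1 h2) (show 0 ≤ 2 * N ^ 2 by positivity)
      have e2 := mul_le_mul_of_nonneg_left (ha₀ j hj le_rfl) (show 0 ≤ 2 * N ^ 2 by positivity)
      linarith
    · have e : (inner ℝ (v j ω) (eucMulVec A.transpose (w i ω)) : ℝ) =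
          inner ℝ (w i ω) (eucMulVec A (v j ω)) := by
        rw [← inner_eucMulVec_left, real_inner_comm]
      simp only [inner_sub_right, inner_add_right, real_inner_smul_right, e]
      rw [real_inner_comm (v i ω) (v j ω), real_inner_comm (v (i - 1) ω) (v j ω)]
      rcases eq_or_ne i j with rfl | hij
      · simp only [if_true]; ring
      · simp only [if_neg hij]; ring
  obtain ⟨ra, rb, rc⟩ := firstOrder_reorth hm g (w := w) (w₀ := w₀) (z := z) (s₀ := s₀)
    (by positivity) hW.tendsto_vec hw₀ hzt horth hH r
  replace rb := rb hr
  simp only [hz] at hs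
  simp only [← hs] at ra rb rc
  have hst : Tendsto s φ.l (𝓝 s₀) := ra.tendsto hzt
  obtain ⟨n1, n2, n3, n4⟩ := firstOrder_normalize hm hst hs₀ne hγ hw
  rw [← hγ₀] at n1
  rw [← hγ₀, ← hw₀'] at n2
  have hD : ((m : ℝ) + 2) * ‖s₀‖ ≤ N * κ := by
    have : (m : ℝ) + 2 ≤ N := by linarith
    exact mul_le_mul this hσκ hσpos.le (by linarith)
  have hjD : (j : ℝ) * ((m + 2) * ‖s₀‖) ≤ N ^ 2 * κ := by
    have := mul_le_mul hjN hD (by positivity) (by linarith)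
    linarith
  refine hW.succ n2 n1 (n4.mono ?_) (fun i h1 h2 => ?_) (fun _ => ?_)
    (fun _ y y₀ hy hy1 hyw => ?_)
  · nlinarith
  · have c1 := n3.inner_right (hW.tendsto_vec i h1 h2)
    rw [hw₀.norm_eq_one h1 h2, mul_one] at c1
    have hne := n1.eventually_ne hγ₀'
    have c2 := (c1.add (rb i h1 h2)).of_norm_le_mul
      (Z := fun ω => (inner ℝ (w i ω) (w (j + 1) ω) : ℝ)) (n1.inv₀ hγ₀') ?_
    · refine c2.mono ?_
      rw [norm_inv, hγ₀, norm_norm, ← div_eq_mul_inv, div_le_iff₀ hσpos]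
      have e1 : (j : ℝ) * (m + 2) ≤ N ^ 2 := by nlinarith
      have e2 : (1 + (j : ℝ) * (m + 2)) * ‖s₀‖ ≤ 2 * N ^ 2 * ‖s₀‖ :=
        mul_le_mul_of_nonneg_right (by linarith) hσpos.le
      linarith
    · filter_upwards [hne] with ω h
      have : (inner ℝ (w i ω) (w (j + 1) ω) : ℝ) =
          (inner ℝ (w i ω) (γ (j + 1) ω • w (j + 1) ω - s ω) + inner ℝ (w i ω) (s ω)) *
            (γ (j + 1) ω)⁻¹ := by
        rw [inner_sub_right, real_inner_smul_right]
        field_simp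
        ring
      rw [this, norm_mul]
  · refine ((n3.add ra).add he).congr ?_ fun ω => ?_
    · have e1 : (j : ℝ) * ((r + 11) * N ^ 2 * κ + 2 * (j * ((m + 2) * ‖s₀‖))) ≤
          N * ((r + 13) * N ^ 2 * κ) := by
        refine mul_le_mul hjN (by linarith) (by positivity) (by linarith)
      have e2 := mul_le_mul_of_nonneg_left e1 (Nat.cast_nonneg' (α := ℝ) r)
      have e3 : N ^ 2 * κ * 3 ≤ N ^ 2 * κ * N := by gcongr
      nlinarith
    · rw [hd']; abel
  · have c1 := (n3.add he).inner_right hy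
    have c2 := rc y y₀ hy hy1 fun i h1 h2 => hyw i h1 (by omega)
    refine (c1.add c2).congr ?_ fun ω => ?_
    · have e1 := mul_le_of_le_one_right
        (show 0 ≤ ‖s₀‖ + 2 * N ^ 2 * κ by positivity) hy1
      have e2 := mul_le_mul_of_nonneg_left hjD (Nat.cast_nonneg' (α := ℝ) r)
      nlinarith
    · rw [hd', ← inner_add_right]
      congr 1
      abel

end FloatFamily

theorem IsLanczosBidiag.dims_pos {m n : ℕ} {A : Matrix (Fin m) (Fin n) ℝ}
    {b : EuclideanSpace ℝ (Fin m)} {k : ℕ} {p : ℕ → EuclideanSpace ℝ (Fin m)}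
    {q : ℕ → EuclideanSpace ℝ (Fin n)} {α β : ℕ → ℝ} (h : IsLanczosBidiag A b k p q α β) :
    0 < m ∧ 0 < n := by
  constructor
  · rcases Nat.eq_zero_or_pos m with rfl | hm
    · refine absurd ?_ (h.beta_ne_zero 1 le_rfl (by omega))
      rw [h.beta_one, Subsingleton.elim b 0, norm_zero]
    · exact hm
  · rcases Nat.eq_zero_or_pos n with rfl | hn
    · refine absurd ?_ (h.alpha_ne_zero 1 le_rfl (by omega))
      rw [h.alpha_one, Subsingleton.elim (eucMulVec _ _) 0, norm_zero]
    · exact hn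

namespace FloatFamily

variable {Ω : Type*} {φ : FloatFamily Ω} {m n : ℕ}

/-- The computed bidiagonalization satisfies the exact recurrences up to residuals of size
`O(u ‖A‖)`, and its vectors are orthonormal up to `O(u)`, with constants that depend on the
dimensions and on `r` only. The convention `q 0 = 0` gives the first recurrence for `q` the general
form. -/
theorem nearlyLanczos_of_isLBFRO (g : GramSchmidtKind) {r : ℕ} (hr : 1 ≤ r) {k : ℕ} (hk : 1 ≤ k)
    {A : Matrix (Fin m) (Fin n) ℝ} {b : EuclideanSpace ℝ (Fin m)}
    {p₀ : ℕ → EuclideanSpace ℝ (Fin m)} {q₀ : ℕ → EuclideanSpace ℝ (Fin n)} {α₀ β₀ : ℕ → ℝ}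
    (h₀ : IsLanczosBidiag A b k p₀ q₀ α₀ β₀) (hq₀ : q₀ 0 = 0)
    {p : ℕ → Ω → EuclideanSpace ℝ (Fin m)} {q : ℕ → Ω → EuclideanSpace ℝ (Fin n)}
    {α β : ℕ → Ω → ℝ}
    (hrun : ∀ ω, (φ.F ω).IsLBFRO g r A b k (p · ω) (q · ω) (α · ω) (β · ω))
    (hq : ∀ ω, q 0 ω = 0) :
    φ.FirstOrder ‖b‖ (fun ω => β 1 ω • p 1 ω - b) ∧
    ∀ j, 1 ≤ j → j ≤ k + 1 →
      NearlyLanczos φ (m + n + k) ‖A‖ r 2 p p₀ β β₀ (fun i ω =>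
        β i ω • p i ω - (eucMulVec A (q (i - 1) ω) - α (i - 1) ω • p (i - 1) ω)) j ∧
      NearlyLanczos φ (m + n + k) ‖A‖ r 1 q q₀ α α₀ (fun i ω =>
        α i ω • q i ω - (eucMulVec A.transpose (p i ω) - β i ω • q (i - 1) ω)) j := by
  obtain ⟨hm, hn⟩ := h₀.dims_pos
  have hm1 : (1 : ℝ) ≤ m := by exact_mod_cast hm
  have hn1 : (1 : ℝ) ≤ n := by exact_mod_cast hn
  have hk1 : (1 : ℝ) ≤ k := by exact_mod_cast hk
  set N : ℝ := m + n + k with hN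
  have hN3 : 3 ≤ N := by linarith
  have hN9 : 9 ≤ N ^ 2 := by nlinarith
  set κ := ‖A‖ with hκ
  have hκ0 : 0 ≤ κ := norm_nonneg A
  have hα : ∀ i, 1 ≤ i → i ≤ k + 1 → |α₀ i| ≤ κ := fun i h1 h2 => by
    rw [abs_of_pos (h₀.alpha_pos h1 h2)]
    exact h₀.alpha_le hq₀ h1 h2
  have hβ : ∀ i, 1 ≤ i → i ≤ k → |β₀ (i + 1)| ≤ κ := fun i h1 h2 => by
    rw [abs_of_pos (h₀.beta_pos (by omega) (by omega))]
    exact h₀.beta_succ_le hq₀ h1 h2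
  have hb : b ≠ 0 := by
    have := h₀.beta_ne_zero 1 le_rfl (by omega)
    rw [h₀.beta_one] at this
    exact norm_ne_zero_iff.1 this
  obtain ⟨p1, p2, p3, p4⟩ := firstOrder_normalize (φ := φ) (s := fun _ => b) (w := p 1) (γ := β 1)
    hm tendsto_const_nhds hb (fun ω => (hrun ω).beta_one) (fun ω => (hrun ω).p_one)
  rw [← h₀.beta_one] at p1
  rw [← h₀.beta_one, ← h₀.p_one] at p2
  refine ⟨p3, fun j h1 => ?_⟩
  induction j, h1 using Nat.le_induction with
  | base =>
    intro _
    constructor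
    · refine NearlyLanczos.succ (j := 0) ⟨by omega, by omega, by omega, by omega, by omega⟩ p2 p1
        (p4.mono (by nlinarith)) (by omega) (by omega) (by omega)
    · have e1 := firstOrder_matVec hm A.transpose p2
      rw [norm_transpose_eq, (h₀.orthonormal hq₀ le_rfl (by omega)).1.norm_eq_one le_rfl le_rfl,
        mul_one, ← hκ] at e1
      have e2 := e1.tendsto (((continuous_eucMulVec A.transpose).tendsto _).comp p2)
      have hne : eucMulVec A.transpose (p₀ 1) ≠ 0 := by
        have := h₀.alpha_ne_zero 1 le_rfl (by omega)
        rw [h₀.alpha_one] at this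
        exact norm_ne_zero_iff.1 this
      obtain ⟨q1, q2, q3, q4⟩ := firstOrder_normalize (w := q 1) (γ := α 1) hn e2 hne
        (fun ω => (hrun ω).alpha_one) (fun ω => (hrun ω).q_one)
      rw [← h₀.alpha_one] at q1 q3
      rw [← h₀.alpha_one, ← h₀.q_one] at q2
      have hα1 := h₀.alpha_le hq₀ (j := 1) le_rfl (by omega)
      have res : φ.FirstOrder (2 * N ^ 2 * κ) (fun ω =>
          α 1 ω • q 1 ω - (eucMulVec A.transpose (p 1 ω) - β 1 ω • q (1 - 1) ω)) := by
        refine (q3.add e1).congr ?_ fun ω => ?_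
        · have : ((m : ℝ) + 1) * n ≤ N ^ 2 := by nlinarith
          have := mul_le_mul_of_nonneg_right this hκ0
          have := mul_le_mul_of_nonneg_right hN9 hκ0
          linarith
        · rw [Nat.sub_self, hq]
          simp
      have hNκ : 0 ≤ N ^ 2 * κ := by positivity
      refine NearlyLanczos.succ (j := 0) ⟨by omega, by omega, by omega, by omega, by omega⟩ q2 q1
        (q4.mono (by nlinarith)) (by omega) (fun _ => res.mono ?_) (fun _ y y₀ hy hy1 _ => ?_)
      · have : N ^ 2 * κ * 3 ≤ N ^ 2 * κ * N := by gcongr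
        have : 0 ≤ (r : ℝ) * (r + 13) * (N ^ 3 * κ) := by positivity
        linarith
      · refine (res.inner_right hy).mono ?_
        have := mul_le_of_le_one_right (show 0 ≤ 2 * N ^ 2 * κ by positivity) hy1
        have : 0 ≤ (r : ℝ) * (N ^ 2 * κ) := by positivity
        linarith
  | succ j h1 ih =>
    intro hj
    obtain ⟨hP, hQ⟩ := ih (by omega)
    obtain ⟨hp₀, hq₀'⟩ := h₀.orthonormal hq₀ (j := j + 1) (by omega) hj
    have hjN : (j : ℝ) ≤ N := by
      have : (j : ℝ) ≤ k := by exact_mod_cast (show j ≤ k by omega)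
      linarith
    have hδ : ∀ i l : ℕ, 1 ≤ i → i < l → l ≤ j → φ.FirstOrder (2 * N ^ 2)
        (fun ω => (inner ℝ (q i ω) (q l ω) : ℝ)) := fun i l h1 h2 h3 => by
      simpa only [if_neg h2.ne, sub_zero] using hQ.orth i l h1 (by omega) (by omega) h3
    choose s hs hsγ hsw using fun ω => (hrun ω).p_step j h1 (by omega)
    have hP' : NearlyLanczos φ N κ r 2 p p₀ β β₀ (fun i ω =>
        β i ω • p i ω - (eucMulVec A (q (i - 1) ω) - α (i - 1) ω • p (i - 1) ω)) (j + 1) := by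
      refine NearlyLanczos.step hm hn A g hr (by linarith) h1 hjN hP (hp₀.mono (by omega)) (b := β)
        (hQ.tendsto_vec j h1 le_rfl) (hq₀'.norm_eq_one h1 (by omega)) hQ.tendsto_coef
        (fun i hi hij => hα i hi (by omega)) (fun i hi hij => ?_) (h₀.beta_step j h1 (by omega))
        (h₀.beta_ne_zero _ (by omega) (by omega)) (h₀.p_step j h1 (by omega))
        (fun i hi hij => hQ.orth i j hi hij h1 le_rfl) (fun i hi hij => ?_)
        (fun i hi hij => ?_) hs hsγ hsw (fun ω => by simp only [Nat.add_sub_cancel])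
      · rw [h₀.mulVec_eq h1 (by omega), add_sub_cancel_left, real_inner_smul_right,
          hp₀ i (j + 1) hi (by omega) (by omega) le_rfl, if_neg (by omega), mul_zero]
      · rcases Nat.lt_or_ge 1 i with hi1 | hi1
        · refine ((hδ (i - 1) j (by omega) (by omega) le_rfl).mul
            (hP.tendsto_coef i hi hij)).congr ?_ fun ω => mul_comm _ _
          have := hβ (i - 1) (by omega) (by omega)
          rw [Nat.sub_add_cancel hi] at this
          exact mul_le_mul_of_nonneg_left this (by positivity)
        · obtain rfl : i = 1 := by omega
          refine FirstOrder.zero.congr (by positivity) fun ω => ?_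
          rw [Nat.sub_self, hq, inner_zero_left, mul_zero]
      · refine (hQ.residual_inner i hi hi hij (q j) (q₀ j) (hQ.tendsto_vec j h1 le_rfl)
          (hq₀'.norm_eq_one h1 (by omega)).le fun l hl hli => ?_).congr le_rfl fun ω => ?_
        · rw [hq₀' l j hl (by omega) h1 (by omega), if_neg (by omega)]
        · congr 1; abel
    refine ⟨hP', ?_⟩
    choose t ht htγ htw using fun ω => (hrun ω).q_step j h1 (by omega)
    have htr := norm_transpose_eq A
    have key := NearlyLanczos.step (φ := φ) (N := N) (r := r) (i₀ := 1) (j := j) hn hm A.transpose g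
      hr (by linarith) h1 hjN (w := q) (w₀ := q₀) (γ := α) (γ₀ := α₀) (d := fun i ω =>
        α i ω • q i ω - (eucMulVec A.transpose (p i ω) - β i ω • q (i - 1) ω))
      (v := fun i => p (i + 1)) (v₀ := p₀ (j + 1)) (a := fun i => β (i + 1))
      (a₀ := fun i => β₀ (i + 1)) (b := α) (s := t)
    rw [htr] at key
    refine key hQ (hq₀'.mono (by omega)) (hP'.tendsto_vec _ (by omega) le_rfl)
      (hp₀.norm_eq_one (by omega) le_rfl) (fun i hi hij => hP'.tendsto_coef _ (by omega) (by omega))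
      (fun i hi hij => hβ i hi (by omega)) (fun i hi hij => ?_) (h₀.alpha_step j h1 (by omega))
      (h₀.alpha_ne_zero _ (by omega) (by omega)) (h₀.q_step j h1 (by omega))
      (fun i hi hij => ?_) (fun i hi hij => ?_)
      (fun i hi hij => ?_) ht htγ htw (fun ω => by simp only [Nat.add_sub_cancel])
    · rw [h₀.transpose_mulVec_eq hq₀ (by omega) hj, Nat.add_sub_cancel, add_sub_cancel_right,
        real_inner_smul_right, hq₀' i (j + 1) hi (by omega) (by omega) le_rfl, if_neg (by omega),
        mul_zero]
    · simpa only [add_left_inj] using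
        hP'.orth (i + 1) (j + 1) (by omega) (by omega) (by omega) le_rfl
    · have e := hP'.orth i (j + 1) hi (by omega) (by omega) le_rfl
      simp only [if_neg (show i ≠ j + 1 by omega), sub_zero] at e
      refine (e.mul (hQ.tendsto_coef i hi hij)).congr ?_ fun ω => ?_
      · exact mul_le_mul_of_nonneg_left (hα i hi (by omega)) (by positivity)
      · rw [Nat.sub_add_cancel hi, mul_comm]
    · refine (hP'.residual_inner (i + 1) (by omega) (by omega) (by omega) (p (j + 1)) (p₀ (j + 1))
          (hP'.tendsto_vec _ (by omega) le_rfl) (hp₀.norm_eq_one (by omega) le_rfl).le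
          fun l hl hli => ?_).congr le_rfl fun ω => ?_
      · rw [hp₀ l (j + 1) hl (by omega) (by omega) le_rfl, if_neg (by omega)]
      · rw [Nat.sub_add_cancel hi, Nat.add_sub_cancel, Matrix.transpose_transpose]
        congr 1; abel

end FloatFamily

/-! ### Orthonormalization of nearly orthonormal vectors -/

/-- Nearly orthonormal vectors are close to orthonormal ones. These are the images of the standard
basis under the isometric factor in the polar decomposition of `x ↦ ∑ x i • v i`. In contrast to
the Gram–Schmidt process, this gives a bound polynomial in the number of vectors at once. -/
theorem exists_orthonormal_near {E : Type*} [NormedAddCommGroup E] [InnerProductSpace ℝ E]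
    [FiniteDimensional ℝ E] {N : ℕ} {v : Fin N → E} {ε : ℝ}
    (hv : ∀ i j, |inner ℝ (v i) (v j) - (if i = j then (1 : ℝ) else 0)| ≤ ε)
    (hε : N ^ 2 * ε < 1) :
    ∃ e : Fin N → E, Orthonormal ℝ e ∧ ∀ i, ‖e i - v i‖ ≤ N ^ 3 * ε := by
  classical
  let T : EuclideanSpace ℝ (Fin N) →ₗ[ℝ] E :=
    { toFun := fun x => ∑ i, x i • v i
      map_add' := fun x y => by simp [add_smul, Finset.sum_add_distrib]
      map_smul' := fun c x => by simp [mul_smul, Finset.smul_sum] }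
  have hT : ∀ x, T x = ∑ i, x i • v i := fun x => rfl
  have hsymm : (LinearMap.adjoint T ∘ₗ T).IsSymmetric := fun x y => by
    simp [LinearMap.adjoint_inner_left, LinearMap.adjoint_inner_right]
  have hdim : Module.finrank ℝ (EuclideanSpace ℝ (Fin N)) = N := by simp
  set U := hsymm.eigenvectorBasis hdim with hU
  set d : Fin N → ℝ := fun a => ‖T (U a)‖ ^ 2 with hd
  have horth : ∀ a b, a ≠ b → inner ℝ (T (U a)) (T (U b)) = (0 : ℝ) := fun a b hab => by
    rw [← LinearMap.adjoint_inner_left, ← LinearMap.comp_apply, hU,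
      hsymm.apply_eigenvectorBasis hdim a, ← hU, real_inner_smul_left]
    simp [U.orthonormal.2 hab]
  have hUabs : ∀ a i, |U a i| ≤ 1 := fun a i => by
    have := PiLp.norm_apply_le (U a) i
    rwa [U.orthonormal.1 a] at this
  have hd1 : ∀ a, |d a - 1| ≤ N ^ 2 * ε := fun a => by
    have e1 : d a = ∑ i, ∑ j, U a i * U a j * inner ℝ (v i) (v j) := by
      simp only [hd]
      rw [← real_inner_self_eq_norm_sq, hT, sum_inner]
      refine Finset.sum_congr rfl fun i _ => ?_
      rw [inner_sum]
      refine Finset.sum_congr rfl fun j _ => ?_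
      rw [real_inner_smul_left, real_inner_smul_right, mul_assoc]
    have e2 : (1 : ℝ) = ∑ i, ∑ j, U a i * U a j * (if i = j then (1 : ℝ) else 0) := by
      have := U.orthonormal.1 a
      rw [EuclideanSpace.norm_eq, Real.sqrt_eq_one] at this
      simp only [Real.norm_eq_abs, sq_abs] at this
      simp only [mul_ite, mul_one, mul_zero, Finset.sum_ite_eq, Finset.mem_univ, if_true, ← sq]
      exact this.symm
    have e3 : d a - 1 = ∑ i, ∑ j, U a i * U a j *
        (inner ℝ (v i) (v j) - if i = j then (1 : ℝ) else 0) := by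
      simp only [mul_sub, Finset.sum_sub_distrib]
      rw [← e1, ← e2]
    rw [e3]
    refine (Finset.abs_sum_le_sum_abs _ _).trans ((Finset.sum_le_sum fun i _ =>
      (Finset.abs_sum_le_sum_abs _ _).trans (Finset.sum_le_sum (g := fun _ => ε)
        fun j _ => ?_)).trans ?_)
    · rw [abs_mul, abs_mul]
      have h1 : |U a i| * |U a j| ≤ 1 := mul_le_one₀ (hUabs a i) (abs_nonneg _) (hUabs a j)
      exact (mul_le_of_le_one_left (abs_nonneg _) h1).trans (hv i j)
    · simp [sq, mul_assoc]
  have hdpos : ∀ a, 0 < d a := fun a => by linarith [(abs_le.1 (hd1 a)).1]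
  have hsq : ∀ a, √(d a) = ‖T (U a)‖ := fun a => Real.sqrt_sq (norm_nonneg _)
  have hnpos : ∀ a, 0 < ‖T (U a)‖ := fun a => by rw [← hsq]; exact Real.sqrt_pos.2 (hdpos a)
  set o : Fin N → E := fun a => ‖T (U a)‖⁻¹ • T (U a) with ho
  have hoo : Orthonormal ℝ o := by
    refine ⟨fun a => ?_, fun a b hab => ?_⟩
    · rw [ho, norm_smul, norm_inv, norm_norm, inv_mul_cancel₀ (hnpos a).ne']
    · simp only [ho]
      rw [real_inner_smul_left, real_inner_smul_right, horth a b hab, mul_zero, mul_zero]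
  set S : EuclideanSpace ℝ (Fin N) → E := fun x => ∑ a, inner ℝ (U a) x • o a with hS
  have hSS : ∀ x y, inner ℝ (S x) (S y) = (inner ℝ x y : ℝ) := fun x y => by
    rw [hS, hoo.inner_sum, ← U.sum_inner_mul_inner x y]
    refine Finset.sum_congr rfl fun a _ => ?_
    rw [real_inner_comm (U a) x]
    simp
  refine ⟨fun i => S (EuclideanSpace.single i 1), ?_, fun i => ?_⟩
  · rw [orthonormal_iff_ite]
    intro i j
    rw [hSS, EuclideanSpace.inner_single_left]
    simp
  · have e1 : v i = ∑ a, inner ℝ (U a) (EuclideanSpace.single i 1) • T (U a) := by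
      have h1 : T (EuclideanSpace.single i 1) = v i := by simp [hT]
      conv_lhs => rw [← h1, ← U.sum_repr' (EuclideanSpace.single i 1)]
      simp
    rw [e1, hS]
    simp only
    rw [← Finset.sum_sub_distrib]
    refine (norm_sum_le _ _).trans ((Finset.sum_le_sum (g := fun _ => N ^ 2 * ε)
      fun a _ => ?_).trans ?_)
    · have e2 : T (U a) = ‖T (U a)‖ • o a := by rw [ho, smul_inv_smul₀ (hnpos a).ne']
      have e3 : |inner ℝ (U a) (EuclideanSpace.single i (1 : ℝ))| ≤ 1 := by
        refine (abs_real_inner_le_norm _ _).trans ?_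
        simp [U.orthonormal.1 a]
      rw [← smul_sub, norm_smul, Real.norm_eq_abs]
      refine (mul_le_of_le_one_left (norm_nonneg _) e3).trans (le_trans ?_ (hd1 a))
      have e4 : o a - T (U a) = (1 - ‖T (U a)‖) • o a := by
        rw [sub_smul, one_smul, ← e2]
      have e5 : d a - 1 = -((1 - ‖T (U a)‖) * (1 + ‖T (U a)‖)) := by simp only [hd]; ring
      rw [e4, norm_smul, hoo.1 a, mul_one, e5, abs_neg, abs_mul, Real.norm_eq_abs]
      refine le_mul_of_one_le_right (abs_nonneg _) ?_
      rw [abs_of_pos (by linarith [hnpos a])]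
      linarith [hnpos a]
    · simp only [Finset.sum_const, Finset.card_univ, Fintype.card_fin, nsmul_eq_mul]
      exact le_of_eq (by ring)

/-- Version of `exists_orthonormal_near` for the vectors `w 1, …, w K` of a sequence. -/
theorem exists_orthonormalUpTo_near {E : Type*} [NormedAddCommGroup E] [InnerProductSpace ℝ E]
    [FiniteDimensional ℝ E] {K : ℕ} {w : ℕ → E} {ε : ℝ}
    (hw : ∀ i j, 1 ≤ i → i ≤ K → 1 ≤ j → j ≤ K →
      |inner ℝ (w i) (w j) - (if i = j then (1 : ℝ) else 0)| ≤ ε)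
    (hε : K ^ 2 * ε < 1) :
    ∃ w' : ℕ → E, w' 0 = 0 ∧ OrthonormalUpTo w' K ∧
      ∀ i, 1 ≤ i → i ≤ K → ‖w' i - w i‖ ≤ K ^ 3 * ε := by
  obtain ⟨e, he, hev⟩ := exists_orthonormal_near (v := fun i : Fin K => w (i + 1)) (ε := ε)
    (fun i j => by
      simpa [Fin.ext_iff] using hw (i + 1) (j + 1) (by omega) (by omega) (by omega) (by omega)) hε
  have hval : ∀ i (h1 : 1 ≤ i) (h2 : i ≤ K),
      (if h : 1 ≤ i ∧ i ≤ K then e ⟨i - 1, by omega⟩ else 0) = e ⟨i - 1, by omega⟩ :=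
    fun i h1 h2 => dif_pos ⟨h1, h2⟩
  refine ⟨fun i => if h : 1 ≤ i ∧ i ≤ K then e ⟨i - 1, by omega⟩ else 0, by simp,
    fun i l h1 h2 h3 h4 => ?_, fun i h1 h2 => ?_⟩
  · beta_reduce
    rw [hval i h1 h2, hval l h3 h4, orthonormal_iff_ite.1 he]
    simp only [Fin.mk.injEq]
    congr 1
    exact propext ⟨fun h => by omega, fun h => by omega⟩
  · beta_reduce
    rw [hval i h1 h2]
    have := hev ⟨i - 1, by omega⟩
    simpa only [Nat.sub_add_cancel h1] using this

/-! ### The backward error matrix -/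

theorem eucMulVec_vecMulVec {m n : ℕ} (x : EuclideanSpace ℝ (Fin m))
    (y z : EuclideanSpace ℝ (Fin n)) :
    eucMulVec (Matrix.vecMulVec x y) z = (inner ℝ y z : ℝ) • x := by
  ext i
  simp [eucMulVec, Matrix.vecMulVec_mulVec, EuclideanSpace.inner_eq_star_dotProduct,
    dotProduct_comm]

theorem norm_vecMulVec_le {m n : ℕ} (x : EuclideanSpace ℝ (Fin m))
    (y : EuclideanSpace ℝ (Fin n)) :
    ‖(Matrix.vecMulVec x y : Matrix (Fin m) (Fin n) ℝ)‖ ≤ ‖x‖ * ‖y‖ := by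
  rw [Matrix.l2_opNorm_def]
  refine ContinuousLinearMap.opNorm_le_bound _ (by positivity) fun z => ?_
  change ‖eucMulVec (Matrix.vecMulVec x y) z‖ ≤ _
  rw [eucMulVec_vecMulVec, norm_smul]
  have := norm_inner_le_norm (𝕜 := ℝ) y z
  nlinarith [norm_nonneg x]

theorem eucMulVec_matrix_sum {m n : ℕ} {ι : Type*} (s : Finset ι)
    (M : ι → Matrix (Fin m) (Fin n) ℝ) (x : EuclideanSpace ℝ (Fin n)) :
    eucMulVec (∑ i ∈ s, M i) x = ∑ i ∈ s, eucMulVec (M i) x := by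
  simp [eucMulVec, Matrix.sum_mulVec, WithLp.toLp_sum]

theorem eucMulVec_sub_matrix {m n : ℕ} (A B : Matrix (Fin m) (Fin n) ℝ)
    (x : EuclideanSpace ℝ (Fin n)) :
    eucMulVec (A - B) x = eucMulVec A x - eucMulVec B x := by
  simp [eucMulVec, Matrix.sub_mulVec]

theorem eucMulVec_smul_matrix {m n : ℕ} (c : ℝ) (A : Matrix (Fin m) (Fin n) ℝ)
    (x : EuclideanSpace ℝ (Fin n)) : eucMulVec (c • A) x = c • eucMulVec A x := by
  simp [eucMulVec, Matrix.smul_mulVec]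

theorem OrthonormalUpTo.sum_inner_smul {E G : Type*} [NormedAddCommGroup E] [InnerProductSpace ℝ E]
    [AddCommGroup G] [Module ℝ G] {w : ℕ → E} {K : ℕ} (hw : OrthonormalUpTo w K) (f : ℕ → G)
    {j : ℕ} (h1 : 1 ≤ j) (h2 : j ≤ K) :
    ∑ i ∈ Finset.Icc 1 K, (inner ℝ (w i) (w j) : ℝ) • f i = f j := by
  rw [Finset.sum_eq_single_of_mem j (Finset.mem_Icc.2 ⟨h1, h2⟩)]
  · rw [hw j j h1 h2 h1 h2, if_pos rfl, one_smul]
  · intro i hi hij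
    rw [Finset.mem_Icc] at hi
    rw [hw i j hi.1 hi.2 h1 h2, if_neg hij, zero_smul]

/-- A matrix with prescribed values `E q j = f j` and `Eᵀ p i = g i` on orthonormal vectors. With
`P`, `Q`, `f`, `g` denoting matrices of columns, it is `f Qᵀ + P gᵀ - P (Pᵀ f) Qᵀ`. -/
theorem exists_matrix_of_orthonormalUpTo {m n K k : ℕ} {p : ℕ → EuclideanSpace ℝ (Fin m)}
    {q g : ℕ → EuclideanSpace ℝ (Fin n)} (hp : OrthonormalUpTo p K) (hq : OrthonormalUpTo q k)
    {f : ℕ → EuclideanSpace ℝ (Fin m)} {η : ℝ}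
    (hfg : ∀ i j, 1 ≤ i → i ≤ K → 1 ≤ j → j ≤ k → inner ℝ (p i) (f j) = (inner ℝ (g i) (q j) : ℝ))
    (hf : ∀ j, 1 ≤ j → j ≤ k → ‖f j‖ ≤ η) (hg : ∀ i, 1 ≤ i → i ≤ K → ‖g i‖ ≤ η) :
    ∃ E : Matrix (Fin m) (Fin n) ℝ, (∀ j, 1 ≤ j → j ≤ k → eucMulVec E (q j) = f j) ∧
      (∀ i, 1 ≤ i → i ≤ K → eucMulVec E.transpose (p i) = g i) ∧ ‖E‖ ≤ (k + K + K * k) * η := by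
  refine ⟨(∑ j ∈ Finset.Icc 1 k, Matrix.vecMulVec (f j) (q j)) +
    (∑ i ∈ Finset.Icc 1 K, Matrix.vecMulVec (p i) (g i)) -
    ∑ i ∈ Finset.Icc 1 K, ∑ j ∈ Finset.Icc 1 k,
      (inner ℝ (p i) (f j) : ℝ) • Matrix.vecMulVec (p i) (q j),
    fun j h1 h2 => ?_, fun i h1 h2 => ?_, ?_⟩
  · simp only [eucMulVec_sub_matrix, eucMulVec_add_matrix, eucMulVec_matrix_sum,
      eucMulVec_smul_matrix, eucMulVec_vecMulVec]
    rw [hq.sum_inner_smul f h1 h2, add_sub_assoc, add_eq_left, sub_eq_zero]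
    refine Finset.sum_congr rfl fun i hi => ?_
    rw [Finset.mem_Icc] at hi
    rw [← hfg i j hi.1 hi.2 h1 h2]
    simp only [smul_comm _ (inner ℝ (q _) (q j) : ℝ)]
    rw [hq.sum_inner_smul (fun j => (inner ℝ (p i) (f j) : ℝ) • p i) h1 h2]
  · simp only [Matrix.transpose_sub, Matrix.transpose_add, Matrix.transpose_sum,
      Matrix.transpose_smul, Matrix.transpose_vecMulVec, eucMulVec_sub_matrix,
      eucMulVec_add_matrix, eucMulVec_matrix_sum, eucMulVec_smul_matrix, eucMulVec_vecMulVec]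
    rw [hp.sum_inner_smul g h1 h2, add_comm, add_sub_assoc, add_eq_left, sub_eq_zero,
      Finset.sum_comm]
    refine Finset.sum_congr rfl fun j _ => ?_
    simp only [smul_comm _ (inner ℝ (p _) (p i) : ℝ)]
    rw [hp.sum_inner_smul (fun i => (inner ℝ (p i) (f j) : ℝ) • q j) h1 h2, real_inner_comm]
  · have b1 : ‖∑ j ∈ Finset.Icc 1 k, (Matrix.vecMulVec (f j) (q j) : Matrix (Fin m) (Fin n) ℝ)‖ ≤
        k * η := by
      refine (norm_sum_le _ _).trans ((Finset.sum_le_sum (g := fun _ => η) fun j hj => ?_).trans ?_)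
      · rw [Finset.mem_Icc] at hj
        refine (norm_vecMulVec_le _ _).trans ?_
        rw [hq.norm_eq_one hj.1 hj.2, mul_one]
        exact hf j hj.1 hj.2
      · simp
    have b2 : ‖∑ i ∈ Finset.Icc 1 K, (Matrix.vecMulVec (p i) (g i) : Matrix (Fin m) (Fin n) ℝ)‖ ≤
        K * η := by
      refine (norm_sum_le _ _).trans ((Finset.sum_le_sum (g := fun _ => η) fun j hj => ?_).trans ?_)
      · rw [Finset.mem_Icc] at hj
        refine (norm_vecMulVec_le _ _).trans ?_
        rw [hp.norm_eq_one hj.1 hj.2, one_mul]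
        exact hg j hj.1 hj.2
      · simp
    have b3 : ‖∑ i ∈ Finset.Icc 1 K, ∑ j ∈ Finset.Icc 1 k, (inner ℝ (p i) (f j) : ℝ) •
        (Matrix.vecMulVec (p i) (q j) : Matrix (Fin m) (Fin n) ℝ)‖ ≤ K * (k * η) := by
      refine (norm_sum_le _ _).trans ((Finset.sum_le_sum (g := fun _ => k * η)
        fun i hi => (norm_sum_le _ _).trans ((Finset.sum_le_sum (g := fun _ => η)
          fun j hj => ?_).trans ?_)).trans ?_)
      · rw [Finset.mem_Icc] at hi hj
        have e1 := norm_vecMulVec_le (p i) (q j)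
        have e2 := norm_inner_le_norm (𝕜 := ℝ) (p i) (f j)
        rw [hp.norm_eq_one hi.1 hi.2, hq.norm_eq_one hj.1 hj.2, one_mul] at e1
        rw [hp.norm_eq_one hi.1 hi.2, one_mul] at e2
        rw [norm_smul]
        exact (mul_le_of_le_one_right (norm_nonneg _) e1).trans (e2.trans (hf j hj.1 hj.2))
      · simp
      · simp
    refine (norm_sub_le _ _).trans ?_
    have := norm_add_le (∑ j ∈ Finset.Icc 1 k,
      (Matrix.vecMulVec (f j) (q j) : Matrix (Fin m) (Fin n) ℝ))
      (∑ i ∈ Finset.Icc 1 K, Matrix.vecMulVec (p i) (g i))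
    linarith

/-! ### The projected least squares problem -/

theorem EuclideanSpace.norm_sq_eq_add_sum {k : ℕ} (z : EuclideanSpace ℝ (Fin (k + 1))) :
    ‖z‖ ^ 2 = z 0 ^ 2 + ∑ i : Fin k, z i.succ ^ 2 := by
  rw [EuclideanSpace.norm_sq_eq, Fin.sum_univ_succ]
  simp

/-- The least squares solution of the projected problem is not zero: a small multiple of the first
unit vector has a smaller residual. -/
theorem projected_solution_ne_zero {α β : ℕ → ℝ} {k : ℕ} (hk : 1 ≤ k) (hα : α 1 ≠ 0)
    (hβ : β 1 ≠ 0) {y : EuclideanSpace ℝ (Fin k)}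
    (hy : ∀ z : EuclideanSpace ℝ (Fin k),
      ‖eucMulVec (bidiagMatrix α β k) y - EuclideanSpace.single 0 (β 1)‖ ≤
        ‖eucMulVec (bidiagMatrix α β k) z - EuclideanSpace.single 0 (β 1)‖) : y ≠ 0 := by
  rintro rfl
  obtain ⟨k, rfl⟩ : ∃ k', k = k' + 1 := ⟨k - 1, by omega⟩
  have hpos : 0 < α 1 ^ 2 + β 2 ^ 2 := by positivity
  -- `c` minimizes the residual along the first unit vector.
  set c : ℝ := α 1 * β 1 / (α 1 ^ 2 + β 2 ^ 2) with hc
  have h := hy (EuclideanSpace.single 0 c)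
  have e0 : eucMulVec (bidiagMatrix α β (k + 1)) 0 = 0 := by simp [eucMulVec]
  rw [e0, zero_sub, norm_neg] at h
  have h2 := pow_le_pow_left₀ (norm_nonneg _) h 2
  have e1 : ∀ i : Fin (k + 2), (eucMulVec (bidiagMatrix α β (k + 1)) (EuclideanSpace.single 0 c) -
      EuclideanSpace.single 0 (β 1) : EuclideanSpace ℝ (Fin (k + 2))) i =
      if i = 0 then c * α 1 - β 1 else if i = 1 then c * β 2 else 0 := fun i => by
    refine Fin.cases ?_ (fun i => ?_) i
    · simp [eucMulVec, bidiagMatrix, mul_comm]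
    · refine Fin.cases ?_ (fun i => ?_) i
      · simp [eucMulVec, bidiagMatrix, mul_comm]
      · simp [eucMulVec, bidiagMatrix, Fin.ext_iff]
  have e2 : ‖eucMulVec (bidiagMatrix α β (k + 1)) (EuclideanSpace.single 0 c) -
      EuclideanSpace.single 0 (β 1)‖ ^ 2 = (c * α 1 - β 1) ^ 2 + (c * β 2) ^ 2 := by
    rw [EuclideanSpace.norm_sq_eq_add_sum, Fin.sum_univ_succ]
    simp only [e1]
    simp [Fin.ext_iff]
  have e3 : ‖(EuclideanSpace.single 0 (β 1) : EuclideanSpace ℝ (Fin (k + 1 + 1)))‖ ^ 2 =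
      β 1 ^ 2 := by simp
  rw [e2, e3] at h2
  have e4 : c * (α 1 ^ 2 + β 2 ^ 2) = α 1 * β 1 := by
    rw [hc]; field_simp
  have e5 : (c * α 1 - β 1) ^ 2 + (c * β 2) ^ 2 = β 1 ^ 2 - c * (α 1 * β 1) := by
    linear_combination c * e4
  have e6 : 0 < c * (α 1 * β 1) := by
    have : c * (α 1 * β 1) = (α 1 * β 1) ^ 2 / (α 1 ^ 2 + β 2 ^ 2) := by rw [hc]; ring
    rw [this]
    positivity
  linarith

theorem OrthonormalUpTo.norm_sum_smul {E : Type*} [NormedAddCommGroup E] [InnerProductSpace ℝ E]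
    {w : ℕ → E} {k : ℕ} (hw : OrthonormalUpTo w k) (y : EuclideanSpace ℝ (Fin k)) :
    ‖∑ j : Fin k, y j • w (j + 1)‖ = ‖y‖ := by
  have ho : Orthonormal ℝ (fun j : Fin k => w (j + 1)) := by
    rw [orthonormal_iff_ite]
    intro i j
    rw [hw _ _ (by omega) (by omega) (by omega) (by omega)]
    simp [Fin.ext_iff]
  rw [← sq_eq_sq₀ (norm_nonneg _) (norm_nonneg _), ← real_inner_self_eq_norm_sq, ho.inner_sum,
    EuclideanSpace.norm_sq_eq]
  simp [sq]

/-! ### From residuals to a backward error -/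

/-- If vectors and coefficients satisfy the recurrences of the bidiagonalization up to small
residuals, and the vectors are nearly orthonormal, then nearby orthonormal vectors together with the
same coefficients are the exact bidiagonalization of a nearby problem. Since the coefficients are
unchanged, so is the projected problem. -/
theorem exists_backward_error {m n k : ℕ} (hk : 1 ≤ k) {A : Matrix (Fin m) (Fin n) ℝ}
    {b : EuclideanSpace ℝ (Fin m)} {p : ℕ → EuclideanSpace ℝ (Fin m)}
    {q : ℕ → EuclideanSpace ℝ (Fin n)} {α β : ℕ → ℝ} {ε η ζ : ℝ}
    (hp : ∀ i j, 1 ≤ i → i ≤ k + 1 → 1 ≤ j → j ≤ k + 1 →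
      |inner ℝ (p i) (p j) - (if i = j then (1 : ℝ) else 0)| ≤ ε)
    (hq : ∀ i j, 1 ≤ i → i ≤ k + 1 → 1 ≤ j → j ≤ k + 1 →
      |inner ℝ (q i) (q j) - (if i = j then (1 : ℝ) else 0)| ≤ ε)
    (hq0 : q 0 = 0) (hε : ((k + 1 : ℕ) : ℝ) ^ 2 * ε < 1)
    (hα : ∀ i, 1 ≤ i → i ≤ k + 1 → 0 < α i ∧ α i ≤ 2 * ‖A‖)
    (hβ : ∀ i, 1 ≤ i → i ≤ k + 1 → 0 < β i)
    (hβ1 : β 1 ≤ 2 * ‖b‖) (hβA : ∀ i, 2 ≤ i → i ≤ k + 1 → β i ≤ 2 * ‖A‖)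
    (hrp : ∀ i, 1 ≤ i → i ≤ k →
      ‖β (i + 1) • p (i + 1) - (eucMulVec A (q i) - α i • p i)‖ ≤ η)
    (hrq : ∀ i, 1 ≤ i → i ≤ k + 1 →
      ‖α i • q i - (eucMulVec A.transpose (p i) - β i • q (i - 1))‖ ≤ η)
    (hb : ‖β 1 • p 1 - b‖ ≤ ζ) {x : EuclideanSpace ℝ (Fin n)}
    (hx : IsProjectedSolution α β q k x) :
    ∃ (E : Matrix (Fin m) (Fin n) ℝ) (δb : EuclideanSpace ℝ (Fin m))
      (xbar : EuclideanSpace ℝ (Fin n)),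
      ‖E‖ ≤ (k + (k + 1 : ℕ) + (k + 1 : ℕ) * k) *
        (5 * ‖A‖ * (((k + 1 : ℕ) : ℝ) ^ 3 * ε) + η) ∧
      ‖δb‖ ≤ 2 * ‖b‖ * (((k + 1 : ℕ) : ℝ) ^ 3 * ε) + ζ ∧
      IsLSQRIterate (A + E) (b + δb) k xbar ∧ xbar ≠ 0 ∧
      ‖x - xbar‖ / ‖xbar‖ ≤ k * (((k + 1 : ℕ) : ℝ) ^ 3 * ε) := by
  obtain ⟨p', -, hpo, hpp⟩ := exists_orthonormalUpTo_near hp hε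
  obtain ⟨q', hq'0, hqo, hqq⟩ := exists_orthonormalUpTo_near hq hε
  set τ : ℝ := ((k + 1 : ℕ) : ℝ) ^ 3 * ε with hτ
  have hτ0 : 0 ≤ τ := (norm_nonneg _).trans (hpp 1 le_rfl (by omega))
  have hsmul : ∀ {M : ℕ} {c C : ℝ} {z : EuclideanSpace ℝ (Fin M)}, 0 < c → c ≤ C → ‖z‖ ≤ τ →
      ‖c • z‖ ≤ C * τ := fun hc hC hz => by
    rw [norm_smul, Real.norm_of_nonneg hc.le]
    exact mul_le_mul hC hz (norm_nonneg _) (hc.le.trans hC)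
  have hmul : ∀ {M M' : ℕ} (B : Matrix (Fin M) (Fin M') ℝ) {z : EuclideanSpace ℝ (Fin M')},
      ‖z‖ ≤ τ → ‖eucMulVec B z‖ ≤ ‖B‖ * τ := fun B z hz =>
    (norm_eucMulVec_le B z).trans (mul_le_mul_of_nonneg_left hz (norm_nonneg _))
  set f : ℕ → EuclideanSpace ℝ (Fin m) := fun j =>
    α j • p' j + β (j + 1) • p' (j + 1) - eucMulVec A (q' j) with hf
  set g : ℕ → EuclideanSpace ℝ (Fin n) := fun i =>
    α i • q' i + β i • q' (i - 1) - eucMulVec A.transpose (p' i) with hg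
  have hfn : ∀ j, 1 ≤ j → j ≤ k → ‖f j‖ ≤ 5 * ‖A‖ * τ + η := fun j h1 h2 => by
    have e : f j = α j • (p' j - p j) + β (j + 1) • (p' (j + 1) - p (j + 1)) -
        eucMulVec A (q' j - q j) +
        (β (j + 1) • p (j + 1) - (eucMulVec A (q j) - α j • p j)) := by
      simp only [hf, eucMulVec_sub, smul_sub]
      abel
    have b1 := hsmul (hα j h1 (by omega)).1 (hα j h1 (by omega)).2 (hpp j h1 (by omega))
    have b2 := hsmul (hβ (j + 1) (by omega) (by omega)) (hβA (j + 1) (by omega) (by omega))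
      (hpp (j + 1) (by omega) (by omega))
    have b3 := hmul A (hqq j h1 (by omega))
    have b4 := hrp j h1 h2
    rw [e]
    refine (norm_add_le _ _).trans ?_
    have c1 := norm_sub_le (α j • (p' j - p j) + β (j + 1) • (p' (j + 1) - p (j + 1)))
      (eucMulVec A (q' j - q j))
    have c2 := norm_add_le (α j • (p' j - p j)) (β (j + 1) • (p' (j + 1) - p (j + 1)))
    linarith
  have hgn : ∀ i, 1 ≤ i → i ≤ k + 1 → ‖g i‖ ≤ 5 * ‖A‖ * τ + η := fun i h1 h2 => by
    have e : g i = α i • (q' i - q i) + β i • (q' (i - 1) - q (i - 1)) -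
        eucMulVec A.transpose (p' i - p i) +
        (α i • q i - (eucMulVec A.transpose (p i) - β i • q (i - 1))) := by
      simp only [hg, eucMulVec_sub, smul_sub]
      abel
    have b1 := hsmul (hα i h1 h2).1 (hα i h1 h2).2 (hqq i h1 h2)
    have b2 : ‖β i • (q' (i - 1) - q (i - 1))‖ ≤ 2 * ‖A‖ * τ := by
      rcases Nat.lt_or_ge 1 i with hi | hi
      · exact hsmul (hβ i h1 h2) (hβA i (by omega) h2) (hqq (i - 1) (by omega) (by omega))
      · obtain rfl : i = 1 := by omega
        rw [Nat.sub_self, hq0, hq'0, sub_zero, smul_zero, norm_zero]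
        positivity
    have b3 := hmul A.transpose (hpp i h1 h2)
    rw [norm_transpose_eq] at b3
    have b4 := hrq i h1 h2
    rw [e]
    refine (norm_add_le _ _).trans ?_
    have c1 := norm_sub_le (α i • (q' i - q i) + β i • (q' (i - 1) - q (i - 1)))
      (eucMulVec A.transpose (p' i - p i))
    have c2 := norm_add_le (α i • (q' i - q i)) (β i • (q' (i - 1) - q (i - 1)))
    linarith
  have hfg : ∀ i j, 1 ≤ i → i ≤ k + 1 → 1 ≤ j → j ≤ k →
      inner ℝ (p' i) (f j) = (inner ℝ (g i) (q' j) : ℝ) := fun i j h1 h2 h3 h4 => by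
    have hq1 : (inner ℝ (q' (i - 1)) (q' j) : ℝ) = if i = j + 1 then 1 else 0 := by
      rcases Nat.lt_or_ge 1 i with hi | hi
      · rw [hqo (i - 1) j (by omega) (by omega) h3 (by omega)]
        congr 1
        exact propext ⟨fun h => by omega, fun h => by omega⟩
      · obtain rfl : i = 1 := by omega
        rw [Nat.sub_self, hq'0, inner_zero_left, if_neg (by omega)]
    simp only [hf, hg, inner_sub_left, inner_sub_right, inner_add_left, inner_add_right,
      real_inner_smul_left, real_inner_smul_right]
    rw [hq1, hpo i j h1 h2 h3 (by omega), hpo i (j + 1) h1 h2 (by omega) (by omega),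
      hqo i j h1 h2 h3 (by omega), real_inner_comm, inner_eucMulVec_left,
      real_inner_comm (q' j)]
    by_cases hij : i = j + 1
    · subst hij; simp
    · by_cases hij' : i = j
      · subst hij'; simp
      · simp [hij, hij']
  obtain ⟨E, hEq, hEp, hE⟩ := exists_matrix_of_orthonormalUpTo hpo (hqo.mono (Nat.le_succ k)) hfg
    hfn hgn
  obtain ⟨y, hy, rfl⟩ := hx
  have hAE : ∀ j, 1 ≤ j → j ≤ k →
      eucMulVec (A + E) (q' j) - α j • p' j = β (j + 1) • p' (j + 1) := fun j h1 h2 => by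
    rw [eucMulVec_add_matrix, hEq j h1 h2]
    simp only [hf]
    abel
  have hAEt : ∀ i, 1 ≤ i → i ≤ k + 1 →
      eucMulVec (A + E).transpose (p' i) - β i • q' (i - 1) = α i • q' i := fun i h1 h2 => by
    rw [Matrix.transpose_add, eucMulVec_add_matrix, hEp i h1 h2]
    simp only [hg]
    abel
  have hAEt1 : eucMulVec (A + E).transpose (p' 1) = α 1 • q' 1 := by
    have := hAEt 1 le_rfl (by omega)
    rwa [Nat.sub_self, hq'0, smul_zero, sub_zero] at this
  have hbδ : b + (β 1 • p' 1 - b) = β 1 • p' 1 := by abel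
  have hnorm : ∀ {M : ℕ} {c : ℝ} {z : EuclideanSpace ℝ (Fin M)}, 0 < c → ‖z‖ = 1 →
      c = ‖c • z‖ := fun hc hz => by rw [norm_smul, hz, mul_one, Real.norm_of_nonneg hc.le]
  have hp1 : ∀ i, 1 ≤ i → i ≤ k + 1 → ‖p' i‖ = 1 := fun i h1 h2 => hpo.norm_eq_one h1 h2
  have hq1 : ∀ i, 1 ≤ i → i ≤ k + 1 → ‖q' i‖ = 1 := fun i h1 h2 => hqo.norm_eq_one h1 h2
  have hynorm := (hqo.mono (Nat.le_succ k)).norm_sum_smul y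
  have hyne : y ≠ 0 := projected_solution_ne_zero hk (hα 1 le_rfl (by omega)).1.ne'
    (hβ 1 le_rfl (by omega)).ne' hy
  have hypos : 0 < ‖y‖ := norm_pos_iff.2 hyne
  refine ⟨E, β 1 • p' 1 - b, ∑ j : Fin k, y j • q' (j + 1), hE, ?_,
    ⟨p', q', α, β, ⟨?_, ?_, ?_, ?_, fun j h1 h2 => ?_, fun j h1 h2 => ?_, fun j h1 h2 => ?_,
      fun j h1 h2 => ?_, fun j h1 h2 => (hα j h1 h2).1.ne', fun j h1 h2 => (hβ j h1 h2).ne'⟩,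
      y, hy, rfl⟩, ?_, ?_⟩
  · have e : β 1 • p' 1 - b = β 1 • (p' 1 - p 1) + (β 1 • p 1 - b) := by
      rw [smul_sub]; abel
    rw [e]
    exact (norm_add_le _ _).trans (add_le_add (hsmul (hβ 1 le_rfl (by omega)) hβ1
      (hpp 1 le_rfl (by omega))) hb)
  · rw [hbδ]
    exact hnorm (hβ 1 le_rfl (by omega)) (hp1 1 le_rfl (by omega))
  · rw [hbδ, inv_smul_smul₀ (hβ 1 le_rfl (by omega)).ne']
  · rw [hAEt1]
    exact hnorm (hα 1 le_rfl (by omega)).1 (hq1 1 le_rfl (by omega))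
  · rw [hAEt1, inv_smul_smul₀ (hα 1 le_rfl (by omega)).1.ne']
  · rw [hAE j h1 h2]
    exact hnorm (hβ _ (by omega) (by omega)) (hp1 _ (by omega) (by omega))
  · rw [hAE j h1 h2, inv_smul_smul₀ (hβ _ (by omega) (by omega)).ne']
  · have := hAEt (j + 1) (by omega) (by omega)
    rw [Nat.add_sub_cancel] at this
    rw [this]
    exact hnorm (hα _ (by omega) (by omega)).1 (hq1 _ (by omega) (by omega))
  · have := hAEt (j + 1) (by omega) (by omega)
    rw [Nat.add_sub_cancel] at this
    rw [this, inv_smul_smul₀ (hα _ (by omega) (by omega)).1.ne']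
  · rw [← norm_pos_iff, hynorm]
    exact hypos
  · rw [hynorm, div_le_iff₀ hypos, ← Finset.sum_sub_distrib]
    refine (norm_sum_le _ _).trans ((Finset.sum_le_sum (g := fun _ => ‖y‖ * τ)
      fun j _ => ?_).trans ?_)
    · rw [← smul_sub, norm_smul, norm_sub_rev]
      exact mul_le_mul (PiLp.norm_apply_le y j) (hqq _ (by omega) (by omega)) (norm_nonneg _)
        (norm_nonneg _)
    · simp only [Finset.sum_const, Finset.card_univ, Fintype.card_fin, nsmul_eq_mul]
      exact le_of_eq (by ring)

/-! ### Uniformity over all computed bidiagonalizations -/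

/-- The entries with index `0` may be replaced. -/
theorem IsLanczosBidiag.update_zero {m n : ℕ} {A : Matrix (Fin m) (Fin n) ℝ}
    {b : EuclideanSpace ℝ (Fin m)} {k : ℕ} {p : ℕ → EuclideanSpace ℝ (Fin m)}
    {q : ℕ → EuclideanSpace ℝ (Fin n)} {α β : ℕ → ℝ} (h : IsLanczosBidiag A b k p q α β)
    (v : EuclideanSpace ℝ (Fin n)) : IsLanczosBidiag A b k p (Function.update q 0 v) α β := by
  have e : ∀ j, 1 ≤ j → Function.update q 0 v j = q j := fun j hj =>
    Function.update_of_ne (by omega) _ _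
  refine ⟨h.beta_one, h.p_one, h.alpha_one, ?_, fun j h1 h2 => ?_, fun j h1 h2 => ?_,
    fun j h1 h2 => ?_, fun j h1 h2 => ?_, h.alpha_ne_zero, h.beta_ne_zero⟩
  · rw [e 1 le_rfl, h.q_one]
  · rw [e j h1, h.beta_step j h1 h2]
  · rw [e j h1, h.p_step j h1 h2]
  · rw [e j h1, h.alpha_step j h1 h2]
  · rw [e j h1, e (j + 1) (by omega), h.q_step j h1 h2]

theorem FloatArith.IsLBFRO.update_zero {u : ℝ} {F : FloatArith u} {g : GramSchmidtKind} {r : ℕ}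
    {m n : ℕ} {A : Matrix (Fin m) (Fin n) ℝ}
    {b : EuclideanSpace ℝ (Fin m)} {k : ℕ} {p : ℕ → EuclideanSpace ℝ (Fin m)}
    {q : ℕ → EuclideanSpace ℝ (Fin n)} {α β : ℕ → ℝ} (h : F.IsLBFRO g r A b k p q α β)
    (v : EuclideanSpace ℝ (Fin n)) : F.IsLBFRO g r A b k p (Function.update q 0 v) α β := by
  have e : ∀ j, 1 ≤ j → Function.update q 0 v j = q j := fun j hj =>
    Function.update_of_ne (by omega) _ _
  have e2 : ∀ j, (List.range' 1 j).map (Function.update q 0 v) = (List.range' 1 j).map q :=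
    fun j => List.map_congr_left fun i hi => e i (by simp at hi; omega)
  refine ⟨h.beta_one, h.p_one, h.alpha_one, ?_, fun j h1 h2 => ?_, fun j h1 h2 => ?_⟩
  · rw [e 1 le_rfl, h.q_one]
  · rw [e j h1]
    exact h.p_step j h1 h2
  · simp only [e j h1, e (j + 1) (by omega), FloatArith.reorth, e2]
    exact h.q_step j h1 h2

/-- A computed bidiagonalization of `A` with starting vector `b`, in some floating point arithmetic
with some positive roundoff unit, normalized by `q 0 = 0`. -/
structure BidiagRun {m n : ℕ} (g : GramSchmidtKind) (r : ℕ) (A : Matrix (Fin m) (Fin n) ℝ)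
    (b : EuclideanSpace ℝ (Fin m)) (k : ℕ) where
  u : ℝ
  u_pos : 0 < u
  F : FloatArith u
  p : ℕ → EuclideanSpace ℝ (Fin m)
  q : ℕ → EuclideanSpace ℝ (Fin n)
  α : ℕ → ℝ
  β : ℕ → ℝ
  isLBFRO : F.IsLBFRO g r A b k p q α β
  q_zero : q 0 = 0

/-- The family of all computed bidiagonalizations of a fixed problem, along `u → 0`. -/
def BidiagRun.family {m n : ℕ} (g : GramSchmidtKind) (r : ℕ) (A : Matrix (Fin m) (Fin n) ℝ)
    (b : EuclideanSpace ℝ (Fin m)) (k : ℕ) : FloatFamily (BidiagRun g r A b k) where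
  u ω := ω.u
  u_nonneg ω := ω.u_pos.le
  F ω := ω.F
  l := Filter.comap (fun ω => ω.u) (𝓝 0)
  tendsto_u := Filter.tendsto_comap

/-- A property of computed bidiagonalizations that holds eventually along `u → 0` holds for all
sufficiently small `u`, uniformly in the rounding errors. -/
theorem BidiagRun.exists_of_eventually {m n : ℕ} {g : GramSchmidtKind} {r : ℕ}
    {A : Matrix (Fin m) (Fin n) ℝ} {b : EuclideanSpace ℝ (Fin m)} {k : ℕ}
    {P : BidiagRun g r A b k → Prop} (h : ∀ᶠ ω in (BidiagRun.family g r A b k).l, P ω) :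
    ∃ u₀ : ℝ, 0 < u₀ ∧ ∀ ω : BidiagRun g r A b k, ω.u ≤ u₀ → P ω := by
  obtain ⟨t, ht, hP⟩ := Filter.mem_comap.1 h
  obtain ⟨δ, hδ, hball⟩ := Metric.mem_nhds_iff.1 ht
  refine ⟨δ / 2, by positivity, fun ω hω => hP (hball ?_)⟩
  rw [Metric.mem_ball, Real.dist_eq, sub_zero, abs_of_pos ω.u_pos]
  linarith

theorem eventually_forall_le {Ω : Type*} {l : Filter Ω} {P : ℕ → Ω → Prop} {a K : ℕ}
    (h : ∀ i, a ≤ i → i ≤ K → ∀ᶠ ω in l, P i ω) :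
    ∀ᶠ ω in l, ∀ i, a ≤ i → i ≤ K → P i ω := by
  have := (Filter.eventually_all_finset (Finset.Icc a K)).2 fun i hi =>
    h i (Finset.mem_Icc.1 hi).1 (Finset.mem_Icc.1 hi).2
  filter_upwards [this] with ω h i h1 h2
  exact h i (Finset.mem_Icc.2 ⟨h1, h2⟩)

/-- Comparison of the constants, with `K = k + 1`, with multiples of the highest power of `N`. -/
theorem backward_error_constants_le {N R K k u : ℝ} (hN : 3 ≤ N) (hR : 0 ≤ R) (hK0 : 0 ≤ K)
    (hK : K ≤ N) (hk0 : 0 ≤ k) (hk : k ≤ N) (hu : 0 ≤ u) :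
    (∀ κ : ℝ, 0 ≤ κ → (k + K + K * k) * (5 * κ * (K ^ 3 * (3 * N ^ 2 * u)) +
      (R + 1) * N ^ 3 * κ * u) ≤ 2 * (R + 16) * N ^ 7 * κ * u) ∧
    (∀ B : ℝ, 0 ≤ B → 2 * B * (K ^ 3 * (3 * N ^ 2 * u)) + 2 * B * u ≤
      2 * (R + 16) * N ^ 7 * B * u) ∧
    k * (K ^ 3 * (3 * N ^ 2 * u)) ≤ 2 * (R + 16) * N ^ 7 * u := by
  have hτ : K ^ 3 * (3 * N ^ 2 * u) ≤ 3 * N ^ 5 * u := by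
    have := mul_le_mul_of_nonneg_right (pow_le_pow_left₀ hK0 hK 3)
      (show 0 ≤ 3 * N ^ 2 * u by positivity)
    linarith
  have hN35 : N ^ 3 ≤ N ^ 5 := pow_le_pow_right₀ (by linarith) (by norm_num)
  have hN57 : N ^ 5 ≤ N ^ 7 := pow_le_pow_right₀ (by linarith) (by norm_num)
  have hN67 : N ^ 6 ≤ N ^ 7 := pow_le_pow_right₀ (by linarith) (by norm_num)
  have hN07 : 1 ≤ N ^ 7 := one_le_pow₀ (by linarith)
  refine ⟨fun κ hκ => ?_, fun B hB => ?_, ?_⟩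
  · have e1 : k + K + K * k ≤ 2 * N ^ 2 := by
      have := mul_le_mul hK hk hk0 (by linarith)
      nlinarith
    have e2 : 5 * κ * (K ^ 3 * (3 * N ^ 2 * u)) + (R + 1) * N ^ 3 * κ * u ≤
        (R + 16) * N ^ 5 * κ * u := by
      have f1 := mul_le_mul_of_nonneg_left hτ (show 0 ≤ 5 * κ by positivity)
      have f2 := mul_le_mul_of_nonneg_right hN35 (show 0 ≤ (R + 1) * κ * u by positivity)
      linarith
    exact (mul_le_mul e1 e2 (by positivity) (by positivity)).trans (le_of_eq (by ring))
  · have f1 := mul_le_mul_of_nonneg_left hτ (show 0 ≤ 2 * B by positivity)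
    have hBu : 0 ≤ B * u := by positivity
    have f2 := mul_le_mul_of_nonneg_right hN57 hBu
    have f3 := mul_le_mul_of_nonneg_right hN07 hBu
    have f4 : 0 ≤ (R + 12) * (N ^ 7 * (B * u)) := by positivity
    linarith
  · have f1 := mul_le_mul hk hτ (by positivity) (by linarith)
    have f2 := mul_le_mul_of_nonneg_right hN67 hu
    have f4 : 0 ≤ (2 * R + 29) * (N ^ 7 * u) := by positivity
    linarith

theorem mainTheorem1 (g : GramSchmidtKind) (r : ℕ) (hr : 1 ≤ r) :
    ∃ c : ℕ → ℕ → ℕ → ℝ,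
      (∃ (C : ℝ) (d : ℕ), ∀ m n k : ℕ, c m n k ≤ C * ((m : ℝ) + n + k) ^ d) ∧
      ∀ (m n k : ℕ), 1 ≤ k →
      ∀ (A : Matrix (Fin m) (Fin n) ℝ) (b : EuclideanSpace ℝ (Fin m)),
      (∃ (p : ℕ → EuclideanSpace ℝ (Fin m)) (q : ℕ → EuclideanSpace ℝ (Fin n)) (α β : ℕ → ℝ),
        IsLanczosBidiag A b k p q α β) →
      ∃ u₀ : ℝ, 0 < u₀ ∧ ∀ u : ℝ, 0 < u → u ≤ u₀ →
        ∀ (F : FloatArith u)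
          (p : ℕ → EuclideanSpace ℝ (Fin m)) (q : ℕ → EuclideanSpace ℝ (Fin n)) (α β : ℕ → ℝ),
          F.IsLBFRO g r A b k p q α β →
          ∀ x : EuclideanSpace ℝ (Fin n), IsProjectedSolution α β q k x →
            ∃ (E : Matrix (Fin m) (Fin n) ℝ) (δb : EuclideanSpace ℝ (Fin m))
              (xbar : EuclideanSpace ℝ (Fin n)),
              ‖E‖ ≤ c m n k * ‖A‖ * u ∧
              ‖δb‖ ≤ c m n k * ‖b‖ * u ∧
              IsLSQRIterate (A + E) (b + δb) k xbar ∧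
              xbar ≠ 0 ∧
              ‖x - xbar‖ / ‖xbar‖ ≤ c m n k * u := by
  refine ⟨fun m n k => 2 * (r * (r + 13) + 19) * ((m : ℝ) + n + k) ^ 7,
    ⟨2 * (r * (r + 13) + 19), 7, fun m n k => le_rfl⟩, fun m n k hk A b hex => ?_⟩
  obtain ⟨p₀, q₀', α₀, β₀, h₀'⟩ := hex
  obtain ⟨q₀, h₀, hq₀⟩ : ∃ q₀, IsLanczosBidiag A b k p₀ q₀ α₀ β₀ ∧ q₀ 0 = 0 :=
    ⟨_, h₀'.update_zero 0, Function.update_self _ _ _⟩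
  obtain ⟨hm, hn⟩ := h₀.dims_pos
  have hm1 : (1 : ℝ) ≤ m := by exact_mod_cast hm
  have hn1 : (1 : ℝ) ≤ n := by exact_mod_cast hn
  have hk1 : (1 : ℝ) ≤ k := by exact_mod_cast hk
  set N : ℝ := m + n + k with hN
  have hN3 : 3 ≤ N := by linarith
  set κ := ‖A‖ with hκ
  set R : ℝ := r * (r + 13) + 3 with hR
  have hR3 : 3 ≤ R := by
    have : (0 : ℝ) ≤ r * (r + 13) := by positivity
    linarith
  have hα₀ : ∀ i, 1 ≤ i → i ≤ k + 1 → 0 < α₀ i ∧ α₀ i ≤ κ := fun i h1 h2 =>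
    ⟨h₀.alpha_pos h1 h2, h₀.alpha_le hq₀ h1 h2⟩
  have hκ0 : 0 < κ := (hα₀ 1 le_rfl (by omega)).1.trans_le (hα₀ 1 le_rfl (by omega)).2
  have hb0 : 0 < ‖b‖ := by
    rw [← h₀.beta_one]
    exact h₀.beta_pos le_rfl (by omega)
  set φ := BidiagRun.family g r A b k with hφ
  obtain ⟨hb, hmain⟩ := FloatFamily.nearlyLanczos_of_isLBFRO (φ := φ) g hr hk h₀ hq₀
    (p := fun i ω => ω.p i) (q := fun i ω => ω.q i) (α := fun i ω => ω.α i)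
    (β := fun i ω => ω.β i) (fun ω => ω.isLBFRO) (fun ω => ω.q_zero)
  obtain ⟨hP, hQ⟩ := hmain (k + 1) (by omega) le_rfl
  -- Each first-order bound holds for small `u` after enlarging its constant a little.
  have hev : ∀ᶠ ω in φ.l,
      (∀ i, 1 ≤ i → i ≤ k + 1 → ∀ j, 1 ≤ j → j ≤ k + 1 →
        |inner ℝ (ω.p i) (ω.p j) - (if i = j then (1 : ℝ) else 0)| ≤ 3 * N ^ 2 * ω.u) ∧
      (∀ i, 1 ≤ i → i ≤ k + 1 → ∀ j, 1 ≤ j → j ≤ k + 1 →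
        |inner ℝ (ω.q i) (ω.q j) - (if i = j then (1 : ℝ) else 0)| ≤ 3 * N ^ 2 * ω.u) ∧
      ((k + 1 : ℕ) : ℝ) ^ 2 * (3 * N ^ 2 * ω.u) < 1 ∧
      (∀ i, 1 ≤ i → i ≤ k + 1 → 0 < ω.α i ∧ ω.α i ≤ 2 * κ) ∧
      (∀ i, 1 ≤ i → i ≤ k + 1 → 0 < ω.β i) ∧ ω.β 1 ≤ 2 * ‖b‖ ∧
      (∀ i, 2 ≤ i → i ≤ k + 1 → ω.β i ≤ 2 * κ) ∧
      (∀ i, 2 ≤ i → i ≤ k + 1 → ‖ω.β i • ω.p i -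
        (eucMulVec A (ω.q (i - 1)) - ω.α (i - 1) • ω.p (i - 1))‖ ≤ (R + 1) * N ^ 3 * κ * ω.u) ∧
      (∀ i, 1 ≤ i → i ≤ k + 1 → ‖ω.α i • ω.q i -
        (eucMulVec A.transpose (ω.p i) - ω.β i • ω.q (i - 1))‖ ≤ (R + 1) * N ^ 3 * κ * ω.u) ∧
      ‖ω.β 1 • ω.p 1 - b‖ ≤ 2 * ‖b‖ * ω.u := by
    have hN2 : 2 * N ^ 2 < 3 * N ^ 2 := by
      have : 0 < N ^ 2 := by positivity
      linarith
    have hRκ : R * N ^ 3 * κ < (R + 1) * N ^ 3 * κ := by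
      have : 0 < N ^ 3 * κ := by positivity
      linarith
    refine .and ?_ (.and ?_ (.and ?_ (.and ?_ (.and ?_ (.and ?_ (.and ?_ (.and ?_ (.and ?_ ?_))))))))
    · exact eventually_forall_le fun i h1 h2 => eventually_forall_le fun j h3 h4 =>
        (hP.orth i j h1 h2 h3 h4).eventually_le hN2
    · exact eventually_forall_le fun i h1 h2 => eventually_forall_le fun j h3 h4 =>
        (hQ.orth i j h1 h2 h3 h4).eventually_le hN2
    · have := (φ.tendsto_u.const_mul (3 * N ^ 2)).const_mul (((k + 1 : ℕ) : ℝ) ^ 2)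
      rw [mul_zero, mul_zero] at this
      exact this.eventually_lt_const one_pos
    · exact eventually_forall_le fun i h1 h2 =>
        ((hQ.tendsto_coef i h1 h2).eventually_const_lt (hα₀ i h1 h2).1).and
          (((hQ.tendsto_coef i h1 h2).eventually_lt_const
            (show α₀ i < 2 * κ by linarith [(hα₀ i h1 h2).2])).mono fun _ h => h.le)
    · exact eventually_forall_le fun i h1 h2 =>
        (hP.tendsto_coef i h1 h2).eventually_const_lt (h₀.beta_pos h1 h2)
    · exact ((hP.tendsto_coef 1 le_rfl (by omega)).eventually_lt_const
        (show β₀ 1 < 2 * ‖b‖ by rw [h₀.beta_one]; linarith)).mono fun _ h => h.le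
    · refine eventually_forall_le fun i h1 h2 => ?_
      have hβ := h₀.beta_succ_le hq₀ (j := i - 1) (by omega) (by omega)
      rw [Nat.sub_add_cancel (by omega)] at hβ
      exact ((hP.tendsto_coef i (by omega) h2).eventually_lt_const
        (show β₀ i < 2 * κ by linarith)).mono fun _ h => h.le
    · exact eventually_forall_le fun i h1 h2 =>
        (hP.residual i h1 (by omega) h2).eventually_le hRκ
    · exact eventually_forall_le fun i h1 h2 => (hQ.residual i h1 h1 h2).eventually_le hRκ
    · exact hb.eventually_le (by linarith)
  obtain ⟨u₀, hu₀, hu⟩ := BidiagRun.exists_of_eventually hev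
  refine ⟨u₀, hu₀, fun u hu0 huu F p q α β hrun x hx => ?_⟩
  obtain ⟨c1, c2, c3, c4, c5, c6, c7, c8, c9, c10⟩ := hu ⟨u, hu0, F, p, Function.update q 0 0, α, β,
    hrun.update_zero 0, Function.update_self _ _ _⟩ huu
  have hx' : IsProjectedSolution α β (Function.update q 0 0) k x := by
    obtain ⟨y, hy, hxy⟩ := hx
    refine ⟨y, hy, hxy.trans (Finset.sum_congr rfl fun j _ => ?_)⟩
    rw [Function.update_of_ne (by omega)]
  obtain ⟨E, δb, xbar, hE, hδ, hL, hne, hrel⟩ := exists_backward_error hk (q := Function.update q 0 0)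
    (fun i j h1 h2 h3 h4 => c1 i h1 h2 j h3 h4) (fun i j h1 h2 h3 h4 => c2 i h1 h2 j h3 h4)
    (Function.update_self _ _ _) c3 c4 c5 c6 c7
    (fun i h1 h2 => c8 (i + 1) (by omega) (by omega)) c9 c10 hx'
  have hKN : (((k + 1 : ℕ) : ℕ) : ℝ) ≤ N := by push_cast; linarith
  have hK0 : (0 : ℝ) ≤ ((k + 1 : ℕ) : ℝ) := Nat.cast_nonneg _
  have hkN : (k : ℝ) ≤ N := by linarith
  have hc : 2 * ((r : ℝ) * (r + 13) + 19) = 2 * (R + 16) := by rw [hR]; ring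
  obtain ⟨e1, e2, e3⟩ := backward_error_constants_le (R := R) hN3 (by linarith) hK0 hKN
    (Nat.cast_nonneg k) hkN hu0.le
  refine ⟨E, δb, xbar, hE.trans ?_, hδ.trans ?_, hL, hne, hrel.trans ?_⟩
  · rw [hc]
    exact e1 κ hκ0.le
  · rw [hc]
    exact e2 ‖b‖ hb0.le
  · rw [hc]
    exact e3
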